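/- All Hilbert spaces are complex and separable, inner products are conjugate linear in the first argument, and $\mathbb B^d$ is the open unit ball of $\mathbb C^d$. A point $z\in\mathbb B^d$ acts as the row operator $z:\mathcal H\otimes\mathbb C^d\to\mathcal H$, $z(h_1,\dots,h_d)=\sum_j z_jh_j$, with adjoint $z^*$, and $zw^*=\sum_j z_j\overline{w_j}$. For a contraction $T$ put $D_T=(I-T^*T)^{1/2}$. **Definitions.** A row contraction is a contraction $T:\mathcal H\otimes\mathbb C^d\to\mathcal H$. It is *CCNC* if $\mathcal H$ is the closed linear span of the subspaces $(I-Tz^*)^{-1}\operatorname{Ran}D_{T^*}$, $z\in\mathbb B^d$. Row operators $T$ on $\mathcal H$ and $T'$ on $\mathcal H'$ are unitarily equivalent, $T\simeq T'$, if $UT=T'(U\otimes I_d)$ for some unitary $U:\mathcal H\to\mathcal H'$. $H^2_d\otimes\mathcal J$ is the reproducing kernel Hilbert space on $\mathbb B^d$ with kernel $(1-zw^*)^{-1}I_{\mathcal J}$. The Schur class $\mathscr S_d(\mathcal J,\mathcal K)$ is the set of functions $b:\mathbb B^d\to\mathscr L(\mathcal J,\mathcal K)$ such that $f\mapsto bf$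 is a contraction from $H^2_d\otimes\mathcal J$ to $H^2_d\otimes\mathcal K$; $b$ is purely contractive if $\|b(z)h\|<\|h\|$ for all $z\in\mathbb B^d$ and $h\neq0$. $\mathscr H(b)$ is the reproducing kernel Hilbert space of $\mathcal K$-valued functions on $\mathbb B^d$ with kernel $k^b(z,w)=\frac{I-b(z)b(w)^*}{1-zw^*}$, and $k^b_0:\mathcal K\to\mathscr H(b)$ is the adjoint of evaluation at $0$. An extremal contractive Gleason solution for $\mathscr H(b)$ is a bounded operator $X:\mathscr H(b)\otimes\mathbb C^d\to\mathscr H(b)$ with $\sum_j z_j(X_j^*f)(z)=f(z)-f(0)$ for all $f\in\mathscr H(b)$, $z\in\mathbb B^d$, and $XX^*=I-k_0^b(k_0^b)^*$. The support of $b\in\mathscr S_d(\mathcal J,\mathcal K)$ is the closed linear span in $\mathcal J$ of the ranges of $b(z)^*$, $z\in\mathbb B^d$. Two such functions $b_1,b_2$ coincide weakly if there are unitaries $R:\mathcal K_1\to\mathcal K_2$ and $Q:\operatorname{supp}b_1\to\operatorname{supp}b_2$ with $Rb_1(z)|_{\operatorname{supp}b_1}=b_2(z)Q$ for all $z\in\mathbb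 B^d$. Let $T$ be a CCNC row contraction, and $V=TP_{\ker D_T}$ its partial isometric part. A model triple $(\gamma,\mathcal J_\infty,\mathcal J_0)$ for $V$ consists of bounded isomorphisms $\gamma(z)$ of $\mathcal J_0$ onto $(\operatorname{Ran}(V-z)V^*V)^\perp$ for $z\in\mathbb B^d$, with $\gamma(0)$ unitary, and a unitary $\gamma(\infty)$ of $\mathcal J_\infty$ onto $\ker V$. Put $b_V(z)=(\gamma(z)^*\gamma(0))^{-1}\,z\,(\gamma(z)^*\otimes I_d)\gamma(\infty)$, $\delta=-\gamma(0)^*T\gamma(\infty)$ and $$b_T^\gamma(z)=D_{\delta^*}^{-1}\,(b_V(z)+\delta)\,(I+\delta^*b_V(z))^{-1}D_\delta .$$ The characteristic function $b_T$ of $T$ is any Schur class function that coincides weakly with $b_T^\gamma$ for some model triple. **Theorem.** Let $T:\mathcal H\otimes\mathbb C^d\to\mathcal H$ be a row contraction. 1. $T$ is CCNC if and only if there are Hilbert spaces $\mathcal J,\mathcal K$, a purely contractive $b\in\mathscr S_d(\mathcal J,\mathcal K)$ and an extremal contractive Gleason solution $X^b$ for $\mathscr H(b)$ with $T\simeq X^b$.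 2. If $T\simeq X^b$ for a purely contractive $b\in\mathscr S_d(\mathcal J,\mathcal K)$ and an extremal contractive Gleason solution $X^b$ for $\mathscr H(b)$, then $b$ is a characteristic function of $T$. 3. The characteristic function is a unitary invariant: if $T_1,T_2$ are unitarily equivalent CCNC row contractions, then any characteristic function of $T_1$ coincides weakly with any characteristic function of $T_2$. -/

import Mathlib

open ContinuousLinearMap

universe u v w

noncomputable section

/-! ### Row operators -/

/-- The open unit ball of `ℂ^d` (with its Euclidean norm). -/
abbrev CBall (d : ℕ) : Type := Metric.ball (0 : EuclideanSpace ℂ (Fin d)) 1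

/-- The centre of the ball. -/
def CBall.origin (d : ℕ) : CBall d := ⟨0, by simp⟩

/-- `H ⊗ ℂ^d`: the Hilbert space direct sum of `d` copies of `H`. -/
abbrev Col (d : ℕ) (H : Type u) : Type u := PiLp 2 (fun _ : Fin d => H)

section RowOperators

variable {d : ℕ} {H : Type u} [NormedAddCommGroup H] [InnerProductSpace ℂ H]
  {H' : Type v} [NormedAddCommGroup H'] [InnerProductSpace ℂ H']

/-- `A ⊗ I_d : H ⊗ ℂ^d → H' ⊗ ℂ^d`, acting as `A` on every component. -/
def ampliation (d : ℕ) (A : H →L[ℂ] H') : Col d H →L[ℂ] Col d H' :=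
  (PiLp.continuousLinearEquiv 2 ℂ (fun _ : Fin d => H')).symm.toContinuousLinearMap ∘L
    ContinuousLinearMap.pi (fun i => A ∘L PiLp.proj 2 (fun _ : Fin d => H) i)

variable (H) in
/-- A point `z` of the ball as a row operator: `(h₁, …, h_d) ↦ z₁ h₁ + ⋯ + z_d h_d`. -/
def pointRow (z : CBall d) : Col d H →L[ℂ] H :=
  ∑ i, (z.1 i) • PiLp.proj 2 (fun _ : Fin d => H) i

/-- Unitary equivalence of the row operators `T` and `T'`: `U T = T' (U ⊗ I_d)` for some
unitary `U`. -/
def RowUnitarilyEquivalent (T : Col d H →L[ℂ] H) (T' : Col d H' →L[ℂ] H') : Prop :=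
  ∃ U : H ≃ₗᵢ[ℂ] H', ∀ h : Col d H,
    U (T h) = T' (LinearIsometryEquiv.piLpCongrRight 2 (fun _ : Fin d => U) h)

end RowOperators

section Defect

variable {H : Type u} [NormedAddCommGroup H] [InnerProductSpace ℂ H] [CompleteSpace H]
  {H' : Type v} [NormedAddCommGroup H'] [InnerProductSpace ℂ H'] [CompleteSpace H']

/-- The defect operator `D_T = (I - T* T)^{1/2}` of a contraction `T`. -/
def defect (T : H →L[ℂ] H') : H →L[ℂ] H := CFC.sqrt (1 - adjoint T ∘L T)

end Defect

section CCNC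

variable {d : ℕ} {H : Type u} [NormedAddCommGroup H] [InnerProductSpace ℂ H] [CompleteSpace H]

/-- The commutative CNC condition: `H` is the closed linear span of the subspaces
`(I - T z*)⁻¹ Ran D_{T*}`, `z` in the ball. -/
def IsCCNC (T : Col d H →L[ℂ] H) : Prop :=
  (⨆ z : CBall d, LinearMap.range
    (Ring.inverse (1 - T ∘L adjoint (pointRow H z)) ∘L defect (adjoint T)).toLinearMap
      ).topologicalClosure = ⊤

/-- The partial isometric part `V = T P_{ker D_T}` of a row contraction `T`. -/
def isometricPart (T : Col d H →L[ℂ] H) : Col d H →L[ℂ] H :=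
  T ∘L (LinearMap.ker (defect T).toLinearMap).starProjection

/-- `Ran (V - z) V* V`. -/
def restrictedRange (V : Col d H →L[ℂ] H) (z : CBall d) : Submodule ℂ H :=
  LinearMap.range ((V - pointRow H z) ∘L adjoint V ∘L V).toLinearMap

end CCNC

/-! ### Vector-valued Drury–Arveson space -/

theorem posSemidef_of_sum_nonneg {X : Type v} {V : Type u} [NormedAddCommGroup V]
    [InnerProductSpace ℂ V] [CompleteSpace V] (K : Matrix X X (V →L[ℂ] V))
    (hK : K.IsHermitian)
    (h : ∀ vv : X →₀ V, 0 ≤ RCLike.re (K := ℂ)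
      (vv.sum fun x w => vv.sum fun x' w' => inner ℂ (K x' x w) w')) : K.PosSemidef := by
  have := (RKHS.posSemidef_tfae (K := K)).out 0 2
  exact this.mpr ⟨hK, h⟩

section DruryArveson

variable (d : ℕ) (J : Type u) [NormedAddCommGroup J] [InnerProductSpace ℂ J] [CompleteSpace J]

/-- The Szegő kernel `(z, w) ↦ (1 - z w*)⁻¹ I_J` of the ball, `z w* = ∑ zᵢ \bar wᵢ`. -/
def szegoKernel : Matrix (CBall d) (CBall d) (J →L[ℂ] J) :=
  Matrix.of fun z w => (1 - inner ℂ w.1 z.1)⁻¹ • (1 : J →L[ℂ] J)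

theorem szegoKernel_posSemidef : (szegoKernel d J).PosSemidef := by
  refine posSemidef_of_sum_nonneg _ ?_ fun vv => ?_
  · ext1 z w
    simp [szegoKernel, Matrix.conjTranspose_apply, Matrix.of_apply, star_smul]
  · have hlt : ∀ x x' : CBall d, ‖inner ℂ x.1 x'.1‖ < 1 := fun x x' => by
      have hx : ‖x.1‖ < 1 := mem_ball_zero_iff.mp x.2
      have hx' : ‖x'.1‖ < 1 := mem_ball_zero_iff.mp x'.2
      exact (norm_inner_le_norm _ _).trans_lt (by nlinarith [norm_nonneg x.1, norm_nonneg x'.1])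
    have hs : HasSum (fun n : ℕ => RCLike.re (K := ℂ) (vv.sum fun x w => vv.sum fun x' w' =>
        (inner ℂ x'.1 x.1) ^ n * inner ℂ w w'))
        (RCLike.re (K := ℂ) (vv.sum fun x w => vv.sum fun x' w' =>
          inner ℂ (szegoKernel d J x' x w) w')) := by
      refine Complex.hasSum_re ?_
      simp only [Finsupp.sum]
      refine hasSum_sum fun x _ => hasSum_sum fun x' _ => ?_
      have := (hasSum_geometric_of_norm_lt_one (hlt x' x)).mul_right (inner ℂ (vv x) (vv x'))
      simpa [szegoKernel, inner_smul_left, mul_comm] using this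
    refine hs.nonneg fun n => ?_
    have key : (vv.sum fun x w => vv.sum fun x' w' =>
        (inner ℂ x'.1 x.1) ^ n * inner ℂ w w') =
        ∑ p : Fin n → Fin d, inner ℂ
          (vv.sum fun x w => (starRingEnd ℂ (∏ k, x.1 (p k))) • w)
          (vv.sum fun x w => (starRingEnd ℂ (∏ k, x.1 (p k))) • w) := by
      simp only [Finsupp.sum, sum_inner]
      simp only [inner_sum]
      rw [Finset.sum_comm (s := (Finset.univ : Finset (Fin n → Fin d)))]
      refine Finset.sum_congr rfl fun x _ => ?_
      rw [Finset.sum_comm (s := (Finset.univ : Finset (Fin n → Fin d)))]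
      refine Finset.sum_congr rfl fun x' _ => ?_
      rw [PiLp.inner_apply, Fintype.sum_pow, Finset.sum_mul]
      refine Finset.sum_congr rfl fun p _ => ?_
      simp only [inner_smul_left, inner_smul_right, RCLike.inner_apply, Finset.prod_mul_distrib,
        map_prod, Complex.conj_conj]
      ring
    rw [key, map_sum]
    exact Finset.sum_nonneg fun p _ => inner_self_nonneg

instance : Fact (szegoKernel d J).PosSemidef := ⟨szegoKernel_posSemidef d J⟩

/-- The vector-valued Drury–Arveson space `H²_d ⊗ J`. -/
def DruryArveson : Type u := RKHS.OfKernel (szegoKernel d J)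

instance : NormedAddCommGroup (DruryArveson d J) :=
  inferInstanceAs (NormedAddCommGroup (RKHS.OfKernel (szegoKernel d J)))
instance : InnerProductSpace ℂ (DruryArveson d J) :=
  inferInstanceAs (InnerProductSpace ℂ (RKHS.OfKernel (szegoKernel d J)))
instance : CompleteSpace (DruryArveson d J) :=
  inferInstanceAs (CompleteSpace (RKHS.OfKernel (szegoKernel d J)))
instance : RKHS ℂ (DruryArveson d J) (CBall d) J :=
  inferInstanceAs (RKHS ℂ (RKHS.OfKernel (szegoKernel d J)) (CBall d) J)

theorem kernel_druryArveson : RKHS.kernel (DruryArveson d J) = szegoKernel d J :=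
  RKHS.OfKernel.kernel_ofKernel (K := szegoKernel d J)

end DruryArveson

/-! ### Schur class and de Branges–Rovnyak spaces -/

/-- The Schur class `S_d(J, K)`: contractive multipliers from `H²_d ⊗ J` to `H²_d ⊗ K`. -/
structure SchurClass (d : ℕ) (J : Type u) (K : Type v)
    [NormedAddCommGroup J] [InnerProductSpace ℂ J] [CompleteSpace J]
    [NormedAddCommGroup K] [InnerProductSpace ℂ K] [CompleteSpace K] where
  /-- The operator-valued function on the ball. -/
  toFun : CBall d → J →L[ℂ] K
  isSchur : ∃ M : DruryArveson d J →L[ℂ] DruryArveson d K, ‖M‖ ≤ 1 ∧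
    ∀ (f : DruryArveson d J) (z : CBall d), M f z = toFun z (f z)

section DeBrangesRovnyak

variable {d : ℕ} {J : Type u} [NormedAddCommGroup J] [InnerProductSpace ℂ J] [CompleteSpace J]
  {K : Type v} [NormedAddCommGroup K] [InnerProductSpace ℂ K] [CompleteSpace K]

instance : CoeFun (SchurClass d J K) (fun _ => CBall d → J →L[ℂ] K) := ⟨SchurClass.toFun⟩

/-- `b` is purely contractive: every `b(z)` is a pure contraction. -/
def SchurClass.IsPurelyContractive (b : SchurClass d J K) : Prop :=
  ∀ (z : CBall d) (h : J), h ≠ 0 → ‖b z h‖ < ‖h‖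

/-- The de Branges–Rovnyak kernel `k^b(z, w) = (I - b(z) b(w)*) / (1 - z w*)`. -/
def dBRKernel (b : SchurClass d J K) : Matrix (CBall d) (CBall d) (K →L[ℂ] K) :=
  Matrix.of fun z w => (1 - inner ℂ w.1 z.1)⁻¹ • (1 - b z ∘L adjoint (b w))

theorem dBRKernel_posSemidef (b : SchurClass d J K) : (dBRKernel b).PosSemidef := by
  obtain ⟨M, hM, hMb⟩ := b.isSchur
  have hadj : ∀ (x : CBall d) (g : K), adjoint M (RKHS.kerFun (DruryArveson d K) x g) =
      RKHS.kerFun (DruryArveson d J) x (adjoint (b x) g) := fun x g => by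
    refine ext_inner_right ℂ fun f => ?_
    rw [adjoint_inner_left, RKHS.kerFun_inner, RKHS.kerFun_inner, hMb, adjoint_inner_left]
  refine posSemidef_of_sum_nonneg _ ?_ fun vv => ?_
  · ext1 z w
    simp [dBRKernel, Matrix.conjTranspose_apply, Matrix.of_apply, star_smul, star_sub,
      star_eq_adjoint, adjoint_comp]
  · set F : DruryArveson d K := vv.sum fun x g => RKHS.kerFun (DruryArveson d K) x g with hF
    have key : (vv.sum fun x g => vv.sum fun x' g' => inner ℂ (dBRKernel b x' x g) g') =
        inner ℂ F F - inner ℂ (adjoint M F) (adjoint M F) := by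
      simp only [hF, Finsupp.sum, map_sum, hadj, sum_inner]
      simp only [inner_sum]
      rw [← Finset.sum_sub_distrib]
      refine Finset.sum_congr rfl fun x _ => ?_
      rw [← Finset.sum_sub_distrib]
      refine Finset.sum_congr rfl fun x' _ => ?_
      rw [← RKHS.kernel_inner, ← RKHS.kernel_inner, kernel_druryArveson, kernel_druryArveson]
      simp only [dBRKernel, szegoKernel, Matrix.of_apply, smul_apply, sub_apply,
        one_apply_eq_self, comp_apply, inner_smul_left, inner_sub_left, mul_sub,
        adjoint_inner_right, map_smul]
    have hle : ‖adjoint M F‖ ≤ ‖F‖ := by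
      refine (le_opNorm _ _).trans ?_
      rw [LinearIsometryEquiv.norm_map]
      exact mul_le_of_le_one_left (norm_nonneg _) hM
    rw [key, map_sub, inner_self_eq_norm_sq, inner_self_eq_norm_sq, sub_nonneg]
    gcongr

instance (b : SchurClass d J K) : Fact (dBRKernel b).PosSemidef := ⟨dBRKernel_posSemidef b⟩

/-- The de Branges–Rovnyak space `ℋ(b)`: the reproducing kernel Hilbert space of `k^b`. -/
def DeBrangesRovnyak (b : SchurClass d J K) : Type v := RKHS.OfKernel (dBRKernel b)

instance (b : SchurClass d J K) : NormedAddCommGroup (DeBrangesRovnyak b) :=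
  inferInstanceAs (NormedAddCommGroup (RKHS.OfKernel (dBRKernel b)))
instance (b : SchurClass d J K) : InnerProductSpace ℂ (DeBrangesRovnyak b) :=
  inferInstanceAs (InnerProductSpace ℂ (RKHS.OfKernel (dBRKernel b)))
instance (b : SchurClass d J K) : CompleteSpace (DeBrangesRovnyak b) :=
  inferInstanceAs (CompleteSpace (RKHS.OfKernel (dBRKernel b)))
instance (b : SchurClass d J K) : RKHS ℂ (DeBrangesRovnyak b) (CBall d) K :=
  inferInstanceAs (RKHS ℂ (RKHS.OfKernel (dBRKernel b)) (CBall d) K)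

theorem kernel_deBrangesRovnyak (b : SchurClass d J K) :
    RKHS.kernel (DeBrangesRovnyak b) = dBRKernel b :=
  RKHS.OfKernel.kernel_ofKernel (K := dBRKernel b)

/-- `X` solves the Gleason problem in `ℋ(b)`:
`z₁ (X₁* f)(z) + ⋯ + z_d (X_d* f)(z) = f(z) - f(0)`. -/
def IsGleasonSolution (b : SchurClass d J K)
    (X : Col d (DeBrangesRovnyak b) →L[ℂ] DeBrangesRovnyak b) : Prop :=
  ∀ (f : DeBrangesRovnyak b) (z : CBall d),
    ∑ i, (z.1 i) • ((adjoint X f : Col d (DeBrangesRovnyak b)) i) z = f z - f (CBall.origin d)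

/-- A Gleason solution `X` is contractive if `X X* ≤ I - k₀ k₀*`. -/
def IsContractiveGleasonSolution (b : SchurClass d J K)
    (X : Col d (DeBrangesRovnyak b) →L[ℂ] DeBrangesRovnyak b) : Prop :=
  IsGleasonSolution b X ∧
    X ∘L adjoint X ≤ 1 - RKHS.kerFun (DeBrangesRovnyak b) (CBall.origin d) ∘L
      adjoint (RKHS.kerFun (DeBrangesRovnyak b) (CBall.origin d))

/-- A contractive Gleason solution `X` is extremal if `X X* = I - k₀ k₀*`. -/
def IsExtremalGleasonSolution (b : SchurClass d J K)
    (X : Col d (DeBrangesRovnyak b) →L[ℂ] DeBrangesRovnyak b) : Prop :=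
  IsContractiveGleasonSolution b X ∧
    X ∘L adjoint X = 1 - RKHS.kerFun (DeBrangesRovnyak b) (CBall.origin d) ∘L
      adjoint (RKHS.kerFun (DeBrangesRovnyak b) (CBall.origin d))

end DeBrangesRovnyak

/-! ### Coincidence of operator-valued functions -/

section Coincidence

variable {d : ℕ} {J₁ : Type*} [NormedAddCommGroup J₁] [InnerProductSpace ℂ J₁]
  {K₁ : Type*} [NormedAddCommGroup K₁] [InnerProductSpace ℂ K₁]
  {J₂ : Type*} [NormedAddCommGroup J₂] [InnerProductSpace ℂ J₂]
  {K₂ : Type*} [NormedAddCommGroup K₂] [InnerProductSpace ℂ K₂]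

/-- `b₁` and `b₂` coincide: `R b₁(z) = b₂(z) Q` for fixed unitaries `R` and `Q`. -/
def Coincide (b₁ : CBall d → J₁ →L[ℂ] K₁) (b₂ : CBall d → J₂ →L[ℂ] K₂) : Prop :=
  ∃ (R : K₁ ≃ₗᵢ[ℂ] K₂) (Q : J₁ ≃ₗᵢ[ℂ] J₂), ∀ (z : CBall d) (h : J₁), R (b₁ z h) = b₂ z (Q h)

/-- The support of `b`: the closed linear span of the ranges of the operators `b(z)*`. -/
def schurSupport [CompleteSpace J₁] [CompleteSpace K₁] (b : CBall d → J₁ →L[ℂ] K₁) :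
    Submodule ℂ J₁ :=
  (⨆ z : CBall d, LinearMap.range (adjoint (b z)).toLinearMap).topologicalClosure

/-- `b₁` and `b₂` coincide weakly: their restrictions to their supports coincide. -/
def CoincideWeakly [CompleteSpace J₁] [CompleteSpace K₁] [CompleteSpace J₂] [CompleteSpace K₂]
    (b₁ : CBall d → J₁ →L[ℂ] K₁) (b₂ : CBall d → J₂ →L[ℂ] K₂) : Prop :=
  Coincide (fun z => b₁ z ∘L (schurSupport b₁).subtypeL)
    (fun z => b₂ z ∘L (schurSupport b₂).subtypeL)

end Coincidence

/-! ### Characteristic functions -/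

/-- A model triple `(γ, J∞, J₀)` for a row partial isometry `V`: bounded linear isomorphisms
`γ(z)` of `J₀` onto `(Ran (V - z) V* V)ᗮ` and a unitary `γ(∞)` of `J∞` onto `ker V`, where `γ(0)`
is also unitary. -/
structure ModelTriple {d : ℕ} {H : Type u}
    [NormedAddCommGroup H] [InnerProductSpace ℂ H] [CompleteSpace H]
    (V : Col d H →L[ℂ] H) (Jinf : Type v) (J0 : Type w)
    [NormedAddCommGroup Jinf] [InnerProductSpace ℂ Jinf] [CompleteSpace Jinf]
    [NormedAddCommGroup J0] [InnerProductSpace ℂ J0] [CompleteSpace J0] where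
  /-- The model map on the ball. -/
  map : CBall d → J0 →L[ℂ] H
  /-- The model map at infinity. -/
  mapInf : Jinf →L[ℂ] Col d H
  injective_map : ∀ z, Function.Injective (map z)
  range_map : ∀ z, LinearMap.range (map z).toLinearMap = (restrictedRange V z)ᗮ
  isometry_map_origin : Isometry (map (CBall.origin d))
  isometry_mapInf : Isometry mapInf
  range_mapInf : LinearMap.range mapInf.toLinearMap = LinearMap.ker V.toLinearMap

section Characteristic

variable {d : ℕ} {H : Type u} [NormedAddCommGroup H] [InnerProductSpace ℂ H] [CompleteSpace H]
  {Jinf : Type v} [NormedAddCommGroup Jinf] [InnerProductSpace ℂ Jinf] [CompleteSpace Jinf]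
  {J0 : Type w} [NormedAddCommGroup J0] [InnerProductSpace ℂ J0] [CompleteSpace J0]

namespace ModelTriple

variable {V : Col d H →L[ℂ] H} (γ : ModelTriple V Jinf J0)

/-- `D(z) = γ(z)* γ(0)`. -/
def denom (z : CBall d) : J0 →L[ℂ] J0 := adjoint (γ.map z) ∘L γ.map (CBall.origin d)

/-- `N(z) = (γ(z)* ⊗ I_d) γ(∞)`. -/
def numer (z : CBall d) : Jinf →L[ℂ] Col d J0 := ampliation d (adjoint (γ.map z)) ∘L γ.mapInf

/-- The characteristic function `b_V(z) = D(z)⁻¹ z N(z)` of the row partial isometry `V`. -/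
def charFun (z : CBall d) : Jinf →L[ℂ] J0 :=
  Ring.inverse (γ.denom z) ∘L pointRow J0 z ∘L γ.numer z

end ModelTriple

/-- The zero-point contraction `δ_T = - γ(0)* T γ(∞)` of a row contraction `T`. -/
def zeroPoint (T : Col d H →L[ℂ] H) (γ : ModelTriple (isometricPart T) Jinf J0) :
    Jinf →L[ℂ] J0 :=
  -(adjoint (γ.map (CBall.origin d)) ∘L T ∘L γ.mapInf)

/-- `c` is the function
`b_T(z) = D_{δ*}⁻¹ (b_V(z) + δ) (I + δ* b_V(z))⁻¹ D_δ`, with `δ = δ_T` and `V` the partial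
isometric part of `T`. Since `δ` is only a pure contraction, `D_{δ*}` is injective but its inverse
may be unbounded, so the factor `D_{δ*}` is put on the other side. -/
def IsModelCharFun (T : Col d H →L[ℂ] H) (γ : ModelTriple (isometricPart T) Jinf J0)
    (c : CBall d → Jinf →L[ℂ] J0) : Prop :=
  ∀ z : CBall d, defect (adjoint (zeroPoint T γ)) ∘L c z =
    (γ.charFun z + zeroPoint T γ) ∘L
      Ring.inverse (1 + adjoint (zeroPoint T γ) ∘L γ.charFun z) ∘L defect (zeroPoint T γ)

/-- The Schur class function `b` is a characteristic function of the row contraction `T`: it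
belongs to the weak coincidence class of the function `b_T` built from a model triple. -/
def IsCharacteristicFunction {J : Type v} {K : Type w}
    [NormedAddCommGroup J] [InnerProductSpace ℂ J] [CompleteSpace J]
    [NormedAddCommGroup K] [InnerProductSpace ℂ K] [CompleteSpace K]
    (T : Col d H →L[ℂ] H) (b : SchurClass d J K) : Prop :=
  ∃ (Jinf : Type u) (J0 : Type u)
    (_ : NormedAddCommGroup Jinf) (_ : InnerProductSpace ℂ Jinf) (_ : CompleteSpace Jinf)
    (_ : NormedAddCommGroup J0) (_ : InnerProductSpace ℂ J0) (_ : CompleteSpace J0)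
    (γ : ModelTriple (isometricPart T) Jinf J0) (c : CBall d → Jinf →L[ℂ] J0),
    IsModelCharFun T γ c ∧ CoincideWeakly b c

end Characteristic

end

/-! Everything passes through one factorization, `IsRealization`: `1 - b(z) b(w)* = (1 - z w*) C (I
- z T*)⁻¹ (I - T w*)⁻¹ C*`, where `C* C = I - T T*` and `C` has dense range. For given `T` it
determines `b` up to weak coincidence. Indeed `C` is fixed by `C* C` up to a unitary of `K`, hence
so are the products `b(z) b(w)*`; these are the Gram operators of the family `b(w)*`, whose ranges
span the support (`IsRealization.coincideWeakly`).

Two sources supply such factorizations. If `U` carries `T` to an extremal Gleason solution, the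
Gleason equation gives `(U h)(z) = (U (I - z T*)⁻¹ h)(0)`, so `C = k₀* U` works: extremality is the
formula for `C* C`, and pure contractivity makes the range dense
(`IsRealization.of_isExtremalGleasonSolution`). On the other side, `T = V - γ(0) δ γ(∞)*` perturbs
`V` only between its defect spaces, and the resolvent identity turns the Möbius formula for `b_T`
into the transfer function `δ + C (I - z T*)⁻¹ z B` of the unitary colligation `[T*, B; C, δ]` with
`B = γ(∞) D_δ` and `C = D_{δ*} γ(0)*` (`isModelCharFun_iff`,
`one_sub_transferFunction_comp_adjoint`). Comparing the two sources shows that a model multiplier is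
a characteristic function; transporting a realization along a unitary gives invariance.

CCNC says that `C (I - z T*)⁻¹ h = 0` for all `z` forces `h = 0` (`isCCNC_iff`). In a Gleason model
this holds because a function vanishing at every point is zero. Conversely, `(I - T z*)⁻¹ C* k ↦
k^b_z k` preserves Gram operators, and under CCNC it extends to a unitary onto `ℋ(b)` that takes `T`
to an extremal Gleason solution (`IsRealization.exists_isExtremalGleasonSolution`). -/

/-! ### Operator families determined by their Gram operators. -/

section GramFamilies

variable {ι V E F G : Type*} [NormedAddCommGroup V] [InnerProductSpace ℂ V]
  [NormedAddCommGroup E] [InnerProductSpace ℂ E] [NormedAddCommGroup F] [InnerProductSpace ℂ F]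
  [NormedAddCommGroup G] [InnerProductSpace ℂ G]

/-- The synthesis map of a family of operators. -/
noncomputable def synthesis (e : ι → V →L[ℂ] E) : (ι →₀ V) →ₗ[ℂ] E :=
  Finsupp.lsum ℂ fun i => (e i).toLinearMap

theorem synthesis_apply (e : ι → V →L[ℂ] E) (v : ι →₀ V) :
    synthesis e v = v.sum fun i x => e i x := by
  simp [synthesis]

theorem synthesis_single (e : ι → V →L[ℂ] E) (i : ι) (x : V) :
    synthesis e (Finsupp.single i x) = e i x := by
  simp [synthesis]

variable [CompleteSpace V] [CompleteSpace E] [CompleteSpace F] [CompleteSpace G]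

theorem inner_synthesis_self (e : ι → V →L[ℂ] E) (v : ι →₀ V) :
    inner ℂ (synthesis e v) (synthesis e v) =
      v.sum fun i x => v.sum fun j y => inner ℂ x ((adjoint (e i) ∘L e j) y) := by
  simp only [synthesis_apply, Finsupp.sum, inner_sum, comp_apply, adjoint_inner_right]
  simp only [sum_inner]
  exact Finset.sum_comm

theorem denseRange_synthesis {e : ι → V →L[ℂ] E}
    (he : ∀ x, (∀ i, adjoint (e i) x = 0) → x = 0) : DenseRange (synthesis e) := by
  have h : (LinearMap.range (synthesis e))ᗮ = ⊥ := by
    refine (Submodule.eq_bot_iff _).mpr fun x hx => he x fun i => ext_inner_left ℂ fun v => ?_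
    rw [adjoint_inner_right, inner_zero_right, ← synthesis_single]
    exact (Submodule.mem_orthogonal _ _).mp hx _ (LinearMap.mem_range_self _ _)
  have h' := (Submodule.topologicalClosure_eq_top_iff (K := LinearMap.range (synthesis e))).mpr h
  have := Submodule.dense_iff_topologicalClosure_eq_top.mpr h'
  simpa only [DenseRange, LinearMap.coe_range] using this

/-- The hypothesis says `‖∑ eᵢ vᵢ‖² = ‖∑ fᵢ vᵢ‖² + ‖∑ gᵢ vᵢ‖²`, so `eᵢ v ↦ fᵢ v` is well defined and
contractive on the span of the ranges, which `he` makes dense. -/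
theorem exists_contraction_of_gram_eq_add {e : ι → V →L[ℂ] E} {f : ι → V →L[ℂ] F}
    {g : ι → V →L[ℂ] G}
    (h : ∀ i j, adjoint (e i) ∘L e j = adjoint (f i) ∘L f j + adjoint (g i) ∘L g j)
    (he : ∀ x, (∀ i, adjoint (e i) x = 0) → x = 0) :
    ∃ L : E →L[ℂ] F, ‖L‖ ≤ 1 ∧ ∀ i x, L (e i x) = f i x := by
  have hn : ∀ v : ι →₀ V, ‖synthesis f v‖ ≤ 1 * ‖synthesis e v‖ := fun v => by
    have key : inner ℂ (synthesis e v) (synthesis e v) =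
        inner ℂ (synthesis f v) (synthesis f v) + inner ℂ (synthesis g v) (synthesis g v) := by
      simp only [inner_synthesis_self, h, add_apply, inner_add_right, Finsupp.sum_add]
    simp only [inner_self_eq_norm_sq_to_K] at key
    have key' : ‖synthesis e v‖ ^ 2 = ‖synthesis f v‖ ^ 2 + ‖synthesis g v‖ ^ 2 := by
      exact_mod_cast key
    rw [one_mul]
    exact (sq_le_sq₀ (norm_nonneg _) (norm_nonneg _)).mp (by nlinarith [sq_nonneg ‖synthesis g v‖])
  have hd := denseRange_synthesis he
  refine ⟨(synthesis f).extendOfNorm (synthesis e),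
    LinearMap.opNorm_extendOfNorm_le hd zero_le_one hn, fun i x => ?_⟩
  simpa only [synthesis_single] using LinearMap.extendOfNorm_eq hd ⟨1, hn⟩ (Finsupp.single i x)

theorem exists_linearIsometryEquiv_of_gram_eq {e : ι → V →L[ℂ] E} {f : ι → V →L[ℂ] F}
    (h : ∀ i j, adjoint (e i) ∘L e j = adjoint (f i) ∘L f j)
    (he : ∀ x, (∀ i, adjoint (e i) x = 0) → x = 0)
    (hf : ∀ x, (∀ i, adjoint (f i) x = 0) → x = 0) :
    ∃ U : E ≃ₗᵢ[ℂ] F, ∀ i x, U (e i x) = f i x := by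
  have hn : ∀ v : ι →₀ V, ‖synthesis f v‖ = ‖synthesis e v‖ := fun v => by
    have key : inner ℂ (synthesis e v) (synthesis e v) =
        inner ℂ (synthesis f v) (synthesis f v) := by
      simp only [inner_synthesis_self, h]
    simp only [inner_self_eq_norm_sq_to_K] at key
    have key' : ‖synthesis e v‖ ^ 2 = ‖synthesis f v‖ ^ 2 := by exact_mod_cast key
    exact ((sq_eq_sq₀ (norm_nonneg _) (norm_nonneg _)).mp key').symm
  refine ⟨(LinearEquiv.refl ℂ (ι →₀ V)).extendOfIsometry (synthesis e) (synthesis f)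
    (denseRange_synthesis he) (denseRange_synthesis hf) hn, fun i x => ?_⟩
  simpa [synthesis_single] using LinearEquiv.extendOfIsometry_eq (LinearEquiv.refl ℂ (ι →₀ V))
    (synthesis e) (synthesis f) (denseRange_synthesis he) (denseRange_synthesis hf) hn
    (Finsupp.single i x)

end GramFamilies

/-! ### Operators intertwining positive square roots. -/

section Intertwining

variable {E F : Type*}
  [NormedAddCommGroup E] [InnerProductSpace ℂ E] [CompleteSpace E]
  [NormedAddCommGroup F] [InnerProductSpace ℂ F] [CompleteSpace F]

theorem eq_zero_of_adjoint_comp_self {Y : E →L[ℂ] F} (h : adjoint Y ∘L Y = 0) : Y = 0 := by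
  have := norm_adjoint_comp_self Y
  rw [h, norm_zero] at this
  exact norm_eq_zero.mp (mul_self_eq_zero.mp this.symm)

theorem adjoint_comp_self_nonneg (Y : E →L[ℂ] F) : 0 ≤ adjoint Y ∘L Y :=
  (nonneg_iff_isPositive _).mpr (isPositive_adjoint_comp_self Y)

/-- If `R Y + Y S = 0` with `R` and `S` positive, then `R Y = 0`. -/
theorem comp_eq_zero_of_sylvester {R : F →L[ℂ] F} {S : E →L[ℂ] E} (hR : 0 ≤ R) (hS : 0 ≤ S)
    {Y : E →L[ℂ] F} (h : R ∘L Y + Y ∘L S = 0) : R ∘L Y = 0 := by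
  have hRs : adjoint R = R := (IsSelfAdjoint.of_nonneg hR).star_eq
  have hSs : adjoint S = S := (IsSelfAdjoint.of_nonneg hS).star_eq
  have hRY : R ∘L Y = -(Y ∘L S) := eq_neg_of_add_eq_zero_left h
  -- `R Y Y* = -Y S Y*` is self-adjoint, so `R` commutes with `Y Y*`; the product is then both
  -- nonnegative and nonpositive.
  have h1 : R * (Y ∘L adjoint Y) = -(Y ∘L S ∘L adjoint Y) := by
    change R ∘L (Y ∘L adjoint Y) = _
    rw [← comp_assoc, hRY, neg_comp, comp_assoc]
  have hYS : 0 ≤ Y ∘L S ∘L adjoint Y :=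
    (nonneg_iff_isPositive _).mpr (((nonneg_iff_isPositive _).mp hS).conj_adjoint Y)
  have hYY : 0 ≤ Y ∘L adjoint Y := by
    simpa using adjoint_comp_self_nonneg (adjoint Y)
  have hsa : IsSelfAdjoint (R * (Y ∘L adjoint Y)) := by
    rw [h1]; exact (IsSelfAdjoint.of_nonneg hYS).neg
  have hc : Commute R (Y ∘L adjoint Y) :=
    ((IsSelfAdjoint.of_nonneg hR).commute_iff (IsSelfAdjoint.of_nonneg hYY)).mpr hsa
  have h0 : R * (Y ∘L adjoint Y) = 0 :=
    le_antisymm (by rw [h1]; exact neg_nonpos.mpr hYS) (hc.mul_nonneg hR hYY)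
  have h2 : adjoint (adjoint (R ∘L Y)) ∘L adjoint (R ∘L Y) = 0 := by
    rw [adjoint_adjoint, adjoint_comp, hRs, comp_assoc, ← comp_assoc Y, ← comp_assoc R]
    change (R * (Y ∘L adjoint Y)) ∘L R = 0
    rw [h0, zero_comp]
  have := eq_zero_of_adjoint_comp_self h2
  rw [← adjoint_adjoint (R ∘L Y), this, map_zero]

/-- An operator intertwining `S²` and `R²`, with `R` and `S` positive, intertwines `S` and `R`. -/
theorem comp_eq_comp_of_comp_sq {R : F →L[ℂ] F} {S : E →L[ℂ] E} (hR : 0 ≤ R) (hS : 0 ≤ S)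
    {X : E →L[ℂ] F} (h : (R ∘L R) ∘L X = X ∘L (S ∘L S)) : R ∘L X = X ∘L S := by
  have hRs : adjoint R = R := (IsSelfAdjoint.of_nonneg hR).star_eq
  have hSs : adjoint S = S := (IsSelfAdjoint.of_nonneg hS).star_eq
  -- The error `Y` satisfies `R Y + Y S = 0`, hence `R Y = 0` and `Y S = 0`; these force `(Y* Y)² =
  -- 0`.
  set Y := R ∘L X - X ∘L S with hY
  have hsyl : R ∘L Y + Y ∘L S = 0 := by
    rw [hY, comp_sub, sub_comp, ← comp_assoc, h, comp_assoc, comp_assoc]; abel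
  have hRY : R ∘L Y = 0 := comp_eq_zero_of_sylvester hR hS hsyl
  have hYS : Y ∘L S = 0 := by rw [hRY, zero_add] at hsyl; exact hsyl
  have hYR : adjoint Y ∘L R = 0 := by
    have := congrArg adjoint hRY
    rwa [adjoint_comp, hRs, map_zero] at this
  have hSY : S ∘L adjoint Y = 0 := by
    have := congrArg adjoint hYS
    rwa [adjoint_comp, hSs, map_zero] at this
  have h1 : adjoint Y ∘L Y = -(adjoint Y ∘L X ∘L S) := by
    conv_lhs => rw [hY]
    rw [← hY, comp_sub, ← comp_assoc, hYR, zero_comp, zero_sub]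
  have h2 : (adjoint Y ∘L Y) ∘L (adjoint Y ∘L Y) = 0 := by
    conv_lhs => lhs; rw [h1]
    rw [neg_comp, comp_assoc, comp_assoc, ← comp_assoc S, hSY]
    simp
  have h3 : adjoint Y ∘L Y = 0 := by
    refine eq_zero_of_adjoint_comp_self ?_
    rwa [adjoint_comp, adjoint_adjoint]
  exact sub_eq_zero.mp (eq_zero_of_adjoint_comp_self h3)

end Intertwining

/-! ### Defect operators of contractions. -/

section DefectOperators

variable {E F : Type*}
  [NormedAddCommGroup E] [InnerProductSpace ℂ E] [CompleteSpace E]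
  [NormedAddCommGroup F] [InnerProductSpace ℂ F] [CompleteSpace F]

theorem one_sub_adjoint_comp_self_nonneg {A : E →L[ℂ] F} (hA : ‖A‖ ≤ 1) :
    0 ≤ 1 - adjoint A ∘L A := by
  refine (nonneg_iff_isPositive _).mpr ?_
  rw [isPositive_def']
  refine ⟨(IsSelfAdjoint.one _).sub (IsSelfAdjoint.of_nonneg (adjoint_comp_self_nonneg A)),
    fun x => ?_⟩
  rw [reApplyInnerSelf_apply, sub_apply, inner_sub_left, map_sub, one_apply_eq_self, comp_apply,
    adjoint_inner_left, inner_self_eq_norm_sq, inner_self_eq_norm_sq, sub_nonneg]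
  have : ‖A x‖ ≤ ‖x‖ := (A.le_opNorm x).trans (mul_le_of_le_one_left (norm_nonneg _) hA)
  gcongr

theorem defect_nonneg (A : E →L[ℂ] F) : 0 ≤ defect A := CFC.sqrt_nonneg _

theorem adjoint_defect (A : E →L[ℂ] F) : adjoint (defect A) = defect A :=
  (IsSelfAdjoint.of_nonneg (defect_nonneg A)).star_eq

theorem defect_comp_self {A : E →L[ℂ] F} (hA : ‖A‖ ≤ 1) :
    defect A ∘L defect A = 1 - adjoint A ∘L A :=
  CFC.sqrt_mul_sqrt_self _ (one_sub_adjoint_comp_self_nonneg hA)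

theorem norm_adjoint_le_one {A : E →L[ℂ] F} (hA : ‖A‖ ≤ 1) : ‖adjoint A‖ ≤ 1 := by
  rwa [LinearIsometryEquiv.norm_map]

/-- At the level of squares this is `(I - A A*) A = A (I - A* A)`, and intertwining passes to
positive square roots. -/
theorem defect_adjoint_comp {A : E →L[ℂ] F} (hA : ‖A‖ ≤ 1) :
    defect (adjoint A) ∘L A = A ∘L defect A := by
  refine comp_eq_comp_of_comp_sq (defect_nonneg _) (defect_nonneg _) ?_
  rw [defect_comp_self hA, defect_comp_self (norm_adjoint_le_one hA), adjoint_adjoint]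
  ext x; simp

theorem comp_eq_zero_iff_of_adjoint_comp_eq {G : Type*} [NormedAddCommGroup G]
    [InnerProductSpace ℂ G] [CompleteSpace G] {A : E →L[ℂ] F} {B : E →L[ℂ] G}
    (h : adjoint A ∘L A = adjoint B ∘L B) (x : E) : A x = 0 ↔ B x = 0 := by
  have : ‖A x‖ ^ 2 = ‖B x‖ ^ 2 := by
    have := congrArg (fun S : E →L[ℂ] E => inner ℂ x (S x)) h
    simp only [comp_apply, adjoint_inner_right, inner_self_eq_norm_sq_to_K] at this
    exact_mod_cast this
  rw [← norm_eq_zero, ← sq_eq_zero_iff, this, sq_eq_zero_iff, norm_eq_zero]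

theorem defect_apply_eq_zero_iff {A : E →L[ℂ] F} (hA : ‖A‖ ≤ 1) (x : E) :
    defect A x = 0 ↔ adjoint A (A x) = x := by
  constructor
  · intro h
    have := congrArg (fun S : E →L[ℂ] E => S x) (defect_comp_self hA)
    simp only [comp_apply, h, map_zero, sub_apply, one_apply_eq_self] at this
    exact (sub_eq_zero.mp this.symm).symm
  · intro h
    have h1 : (adjoint (defect A) ∘L defect A) x = 0 := by
      rw [adjoint_defect, defect_comp_self hA]; simp [h]
    have h2 : inner ℂ (defect A x) (defect A x) = 0 := by
      rw [← adjoint_inner_right, ← comp_apply, h1, inner_zero_right]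
    exact inner_self_eq_zero.mp h2

end DefectOperators

/-! ### Points of the ball as strict row contractions. -/

section PointRow

variable {d : ℕ} {H H' : Type*} [NormedAddCommGroup H] [InnerProductSpace ℂ H]
  [NormedAddCommGroup H'] [InnerProductSpace ℂ H']

theorem pointRow_apply (z : CBall d) (h : Col d H) : pointRow H z h = ∑ i, z.1 i • h i := by
  simp [pointRow]

theorem pointRow_origin : pointRow H (CBall.origin d) = 0 := by
  ext h
  simp [pointRow_apply, CBall.origin]

theorem pointRow_ampliation (z : CBall d) (A : H →L[ℂ] H') :
    pointRow H' z ∘L ampliation d A = A ∘L pointRow H z := by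
  ext h
  simp [pointRow_apply, ampliation, map_sum]

theorem pointRow_piLpCongrRight (z : CBall d) (U : H ≃ₗᵢ[ℂ] H') (h : Col d H) :
    pointRow H' z (LinearIsometryEquiv.piLpCongrRight 2 (fun _ : Fin d => U) h) =
      U (pointRow H z h) := by
  simp [pointRow_apply, map_sum]

variable [CompleteSpace H] [CompleteSpace H']

theorem adjoint_pointRow_apply (z : CBall d) (h : H) :
    adjoint (pointRow H z) h = WithLp.toLp 2 fun i => (starRingEnd ℂ) (z.1 i) • h := by
  refine ext_inner_right ℂ fun g => ?_
  rw [adjoint_inner_left, pointRow_apply, PiLp.inner_apply, inner_sum]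
  simp [inner_smul_left, inner_smul_right]

theorem pointRow_comp_adjoint (z w : CBall d) :
    pointRow H z ∘L adjoint (pointRow H w) = (inner ℂ w.1 z.1 : ℂ) • (1 : H →L[ℂ] H) := by
  ext h
  rw [comp_apply, adjoint_pointRow_apply, pointRow_apply]
  simp only [smul_smul, ← Finset.sum_smul, smul_apply, one_apply_eq_self, PiLp.inner_apply,
    RCLike.inner_apply]

theorem norm_pointRow_le (z : CBall d) : ‖pointRow H z‖ ≤ ‖z.1‖ := by
  have h := norm_adjoint_comp_self (adjoint (pointRow H z))
  rw [adjoint_adjoint, pointRow_comp_adjoint, LinearIsometryEquiv.norm_map] at h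
  refine (mul_self_le_mul_self_iff (norm_nonneg (pointRow H z)) (norm_nonneg z.1)).mpr ?_
  rw [← h, norm_smul, inner_self_eq_norm_sq_to_K, ← sq]
  refine (mul_le_of_le_one_right (norm_nonneg _) ?_).trans (by simp)
  exact opNorm_le_bound _ zero_le_one (by simp)

theorem norm_pointRow_lt_one (z : CBall d) : ‖pointRow H z‖ < 1 :=
  (norm_pointRow_le z).trans_lt (mem_ball_zero_iff.mp z.2)

theorem one_sub_inner_ne_zero (z w : CBall d) : (1 - inner ℂ w.1 z.1 : ℂ) ≠ 0 := by
  intro h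
  have hw : ‖w.1‖ < 1 := mem_ball_zero_iff.mp w.2
  have hz : ‖z.1‖ < 1 := mem_ball_zero_iff.mp z.2
  have h1 : ‖(inner ℂ w.1 z.1 : ℂ)‖ < 1 := (norm_inner_le_norm _ _).trans_lt
    (by nlinarith [norm_nonneg w.1, norm_nonneg z.1])
  rw [← sub_eq_zero.mp h] at h1
  simp at h1

end PointRow

/-! ### The resolvent `(I - z T*)⁻¹`. -/

section Resolvent

variable {d : ℕ} {H H' : Type*} [NormedAddCommGroup H] [InnerProductSpace ℂ H] [CompleteSpace H]
  [NormedAddCommGroup H'] [InnerProductSpace ℂ H'] [CompleteSpace H']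

/-- The resolvent `(I - z T*)⁻¹` of a row contraction. -/
noncomputable def rowResolvent (T : Col d H →L[ℂ] H) (z : CBall d) : H →L[ℂ] H :=
  Ring.inverse (1 - pointRow H z ∘L adjoint T)

theorem isUnit_one_sub_pointRow {T : Col d H →L[ℂ] H} (hT : ‖T‖ ≤ 1) (z : CBall d) :
    IsUnit (1 - pointRow H z ∘L adjoint T) := by
  refine isUnit_one_sub_of_norm_lt_one ((opNorm_comp_le _ _).trans_lt ?_)
  exact (mul_le_of_le_one_right (norm_nonneg _) (norm_adjoint_le_one hT)).trans_lt
    (norm_pointRow_lt_one z)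

theorem one_sub_comp_rowResolvent {T : Col d H →L[ℂ] H} (hT : ‖T‖ ≤ 1) (z : CBall d) :
    (1 - pointRow H z ∘L adjoint T) ∘L rowResolvent T z = 1 :=
  Ring.mul_inverse_cancel _ (isUnit_one_sub_pointRow hT z)

theorem rowResolvent_comp_one_sub {T : Col d H →L[ℂ] H} (hT : ‖T‖ ≤ 1) (z : CBall d) :
    rowResolvent T z ∘L (1 - pointRow H z ∘L adjoint T) = 1 :=
  Ring.inverse_mul_cancel _ (isUnit_one_sub_pointRow hT z)

theorem adjoint_rowResolvent (T : Col d H →L[ℂ] H) (z : CBall d) :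
    adjoint (rowResolvent T z) = Ring.inverse (1 - T ∘L adjoint (pointRow H z)) := by
  rw [rowResolvent, ← star_eq_adjoint, ← Ring.inverse_star, star_sub, star_one, star_eq_adjoint,
    adjoint_comp, adjoint_adjoint]

theorem rowResolvent_origin (T : Col d H →L[ℂ] H) : rowResolvent T (CBall.origin d) = 1 := by
  simp [rowResolvent, pointRow_origin]

end Resolvent

/-! ### Realizations, and their uniqueness up to weak coincidence. -/

section Realization

variable {d : ℕ} {H H' J K J' K' : Type*}
  [NormedAddCommGroup H] [InnerProductSpace ℂ H] [CompleteSpace H]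
  [NormedAddCommGroup H'] [InnerProductSpace ℂ H'] [CompleteSpace H']
  [NormedAddCommGroup J] [InnerProductSpace ℂ J] [CompleteSpace J]
  [NormedAddCommGroup K] [InnerProductSpace ℂ K] [CompleteSpace K]
  [NormedAddCommGroup J'] [InnerProductSpace ℂ J'] [CompleteSpace J']
  [NormedAddCommGroup K'] [InnerProductSpace ℂ K'] [CompleteSpace K']

/-- The function `b` has the de Branges–Rovnyak kernel `C (I - z T*)⁻¹ (I - T w*)⁻¹ C*`, where
`C* C = I - T T*` and `C` has dense range. -/
structure IsRealization (T : Col d H →L[ℂ] H) (C : H →L[ℂ] K) (b : CBall d → J →L[ℂ] K) :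
    Prop where
  adjoint_comp_self : adjoint C ∘L C = 1 - T ∘L adjoint T
  eq_zero_of_adjoint : ∀ k, adjoint C k = 0 → k = 0
  one_sub_comp_adjoint : ∀ z w, 1 - b z ∘L adjoint (b w) =
    (1 - inner ℂ w.1 z.1 : ℂ) • ((C ∘L rowResolvent T z) ∘L adjoint (C ∘L rowResolvent T w))

/-- The adjoint of `b(z)` with values in the support of `b`. -/
noncomputable def adjointToSupport (b : CBall d → J →L[ℂ] K) (z : CBall d) :
    K →L[ℂ] schurSupport b :=
  (adjoint (b z)).codRestrict (schurSupport b) fun k =>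
    Submodule.le_topologicalClosure _ (Submodule.mem_iSup_of_mem z ⟨k, rfl⟩)

instance completeSpace_schurSupport (b : CBall d → J →L[ℂ] K) : CompleteSpace (schurSupport b) :=
  (Submodule.isClosed_topologicalClosure _).completeSpace_coe

theorem adjoint_adjointToSupport (b : CBall d → J →L[ℂ] K) (z : CBall d) :
    adjoint (adjointToSupport b z) = b z ∘L (schurSupport b).subtypeL := by
  refine ContinuousLinearMap.ext fun h => ext_inner_left ℂ fun k => ?_
  rw [adjoint_inner_right, Submodule.coe_inner, comp_apply]
  exact adjoint_inner_left (b z) _ _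

/-- Such a vector is orthogonal to every range of `b(z)*`, hence to the support that contains it.
This is the density needed to build unitaries between supports. -/
theorem eq_zero_of_mem_schurSupport {b : CBall d → J →L[ℂ] K} (x : schurSupport b)
    (h : ∀ z, b z x = 0) : x = 0 := by
  have hx : (x : J) ∈ (schurSupport b)ᗮ := by
    unfold schurSupport
    rw [Submodule.orthogonal_closure, ← Submodule.iInf_orthogonal,
      Submodule.mem_iInf]
    intro z
    rw [Submodule.mem_orthogonal]
    rintro _ ⟨k, rfl⟩
    change inner ℂ (adjoint (b z) k) (x : J) = 0
    rw [adjoint_inner_left, h, inner_zero_right]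
  exact Subtype.ext (inner_self_eq_zero.mp ((Submodule.mem_orthogonal _ _).mp hx _ x.2))

theorem IsRealization.coincideWeakly {T : Col d H →L[ℂ] H} {C : H →L[ℂ] K} {C' : H →L[ℂ] K'}
    {b : CBall d → J →L[ℂ] K} {b' : CBall d → J' →L[ℂ] K'}
    (h : IsRealization T C b) (h' : IsRealization T C' b') : CoincideWeakly b b' := by
  -- `C` and `C'` are one-member families with the common Gram operator `I - T T*` and dense ranges.
  obtain ⟨W, hW⟩ := exists_linearIsometryEquiv_of_gram_eq (ι := Unit) (e := fun _ => C)
    (f := fun _ => C') (fun _ _ => h.adjoint_comp_self.trans h'.adjoint_comp_self.symm)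
    (fun x hx => h.eq_zero_of_adjoint x (hx ())) (fun x hx => h'.eq_zero_of_adjoint x (hx ()))
  set Wc : K →L[ℂ] K' := W.toContinuousLinearEquiv.toContinuousLinearMap with hWc
  have hWC : Wc ∘L C = C' := ContinuousLinearMap.ext fun x => hW () x
  have hWW : adjoint Wc ∘L Wc = 1 := by
    refine ContinuousLinearMap.ext fun x => ext_inner_left ℂ fun y => ?_
    rw [comp_apply, adjoint_inner_right]
    exact W.inner_map_map y x
  have hb : ∀ z w, b z ∘L adjoint (b w) = adjoint Wc ∘L (b' z ∘L adjoint (b' w)) ∘L Wc := by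
    intro z w
    have h1 := h.one_sub_comp_adjoint z w
    have h2 := h'.one_sub_comp_adjoint z w
    have h3 : adjoint Wc ∘L (1 - b' z ∘L adjoint (b' w)) ∘L Wc = 1 - b z ∘L adjoint (b w) := by
      rw [h1, h2, ← hWC]
      simp only [adjoint_comp, smul_comp, comp_smul, comp_assoc]
      rw [hWW]
      simp only [← comp_assoc, hWW]
      rfl
    rw [sub_comp, comp_sub] at h3
    have h4 : adjoint Wc ∘L (1 : K' →L[ℂ] K') ∘L Wc = 1 := hWW
    rw [h4] at h3
    exact (sub_right_injective h3).symm
  -- `hb` equates the Gram operators of `b(z)*` and `b'(z)* W`. The resulting `Q` sends `b(z)* k` to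
  -- `b'(z)* W k`; its adjoint form is the coincidence `W b(z) = b'(z) Q`.
  obtain ⟨Q, hQ⟩ := exists_linearIsometryEquiv_of_gram_eq (e := adjointToSupport b)
    (f := fun z => adjointToSupport b' z ∘L Wc)
    (fun z w => by
      rw [adjoint_comp, adjoint_adjointToSupport, adjoint_adjointToSupport]
      exact hb z w)
    (fun x hx => eq_zero_of_mem_schurSupport x fun z => by
      simpa [adjoint_adjointToSupport] using hx z)
    (fun x hx => eq_zero_of_mem_schurSupport x fun z => by
      have h1 := hx z
      rw [adjoint_comp, adjoint_adjointToSupport] at h1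
      refine ext_inner_left ℂ fun k => ?_
      obtain ⟨k, rfl⟩ := W.surjective k
      have : inner ℂ k (adjoint Wc (b' z x)) = inner ℂ (W k) (b' z x) := adjoint_inner_right _ _ _
      rw [← this, inner_zero_right]
      have h1' : adjoint Wc (b' z x) = 0 := h1
      rw [h1', inner_zero_right])
  refine ⟨W, Q, fun z x => ext_inner_left ℂ fun k => ?_⟩
  obtain ⟨k, rfl⟩ := W.surjective k
  rw [W.inner_map_map]
  have h1 : inner ℂ (Q (adjointToSupport b z k)) (Q x) = inner ℂ (adjointToSupport b z k) x :=
    Q.inner_map_map _ _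
  rw [hQ, ← adjoint_inner_right, ← adjoint_inner_right, adjoint_comp, adjoint_adjointToSupport,
    adjoint_adjointToSupport] at h1
  rw [← h1]
  change inner ℂ k (adjoint Wc _) = _
  rw [adjoint_inner_right]
  rfl

end Realization

/-! ### Transport along a unitary equivalence. -/

section UnitaryEquivalence

variable {d : ℕ} {H H' J K : Type*}
  [NormedAddCommGroup H] [InnerProductSpace ℂ H] [CompleteSpace H]
  [NormedAddCommGroup H'] [InnerProductSpace ℂ H'] [CompleteSpace H']
  [NormedAddCommGroup J] [InnerProductSpace ℂ J] [CompleteSpace J]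
  [NormedAddCommGroup K] [InnerProductSpace ℂ K] [CompleteSpace K]
  {T : Col d H →L[ℂ] H} {T' : Col d H' →L[ℂ] H'} {U : H ≃ₗᵢ[ℂ] H'}

theorem adjoint_apply_of_rowUnitarilyEquivalent
    (hU : ∀ h, U (T h) = T' (LinearIsometryEquiv.piLpCongrRight 2 (fun _ : Fin d => U) h)) (h : H) :
    adjoint T' (U h) =
      LinearIsometryEquiv.piLpCongrRight 2 (fun _ : Fin d => U) (adjoint T h) := by
  refine ext_inner_left ℂ fun y => ?_
  obtain ⟨y, rfl⟩ := (LinearIsometryEquiv.piLpCongrRight 2 (fun _ : Fin d => U)).surjective y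
  rw [adjoint_inner_right, ← hU, U.inner_map_map, LinearIsometryEquiv.inner_map_map,
    adjoint_inner_right]

theorem pointRow_adjoint_apply_of_rowUnitarilyEquivalent
    (hU : ∀ h, U (T h) = T' (LinearIsometryEquiv.piLpCongrRight 2 (fun _ : Fin d => U) h))
    (z : CBall d) (h : H) :
    pointRow H' z (adjoint T' (U h)) = U (pointRow H z (adjoint T h)) := by
  rw [adjoint_apply_of_rowUnitarilyEquivalent hU, pointRow_piLpCongrRight]

theorem comp_adjoint_apply_of_rowUnitarilyEquivalent
    (hU : ∀ h, U (T h) = T' (LinearIsometryEquiv.piLpCongrRight 2 (fun _ : Fin d => U) h)) (h : H) :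
    T' (adjoint T' (U h)) = U (T (adjoint T h)) := by
  rw [adjoint_apply_of_rowUnitarilyEquivalent hU, hU]

theorem adjoint_comp_linearIsometryEquiv (U : H ≃ₗᵢ[ℂ] H') :
    adjoint (U.toContinuousLinearEquiv.toContinuousLinearMap : H →L[ℂ] H') =
      U.symm.toContinuousLinearEquiv.toContinuousLinearMap := by
  refine ContinuousLinearMap.ext fun x => ext_inner_left ℂ fun y => ?_
  rw [adjoint_inner_right]
  have := U.inner_map_map y (U.symm x)
  rw [U.apply_symm_apply] at this
  exact this

theorem rowResolvent_apply_of_rowUnitarilyEquivalent (hT : ‖T‖ ≤ 1) (hT' : ‖T'‖ ≤ 1)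
    (hU : ∀ h, U (T h) = T' (LinearIsometryEquiv.piLpCongrRight 2 (fun _ : Fin d => U) h))
    (z : CBall d) (h : H) : rowResolvent T' z (U h) = U (rowResolvent T z h) := by
  have h1 : (1 - pointRow H' z ∘L adjoint T') (U (rowResolvent T z h)) = U h := by
    have := congrArg (fun S : H →L[ℂ] H => U (S h)) (one_sub_comp_rowResolvent hT z)
    simp only [comp_apply, sub_apply, one_apply_eq_self, map_sub] at this ⊢
    rw [pointRow_adjoint_apply_of_rowUnitarilyEquivalent hU, this]
  rw [← h1, ← comp_apply, rowResolvent_comp_one_sub hT']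
  rfl

theorem IsRealization.of_rowUnitarilyEquivalent (hT : ‖T‖ ≤ 1) (hT' : ‖T'‖ ≤ 1)
    (hU : ∀ h, U (T h) = T' (LinearIsometryEquiv.piLpCongrRight 2 (fun _ : Fin d => U) h))
    {C : H' →L[ℂ] K} {b : CBall d → J →L[ℂ] K} (h : IsRealization T' C b) :
    IsRealization T (C ∘L U.toContinuousLinearEquiv.toContinuousLinearMap) b := by
  set Uc : H →L[ℂ] H' := U.toContinuousLinearEquiv.toContinuousLinearMap with hUc
  have hres : ∀ z, Uc ∘L rowResolvent T z = rowResolvent T' z ∘L Uc := fun z =>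
    ContinuousLinearMap.ext fun x =>
      (rowResolvent_apply_of_rowUnitarilyEquivalent hT hT' hU z x).symm
  have hUU : Uc ∘L adjoint Uc = 1 := by
    rw [adjoint_comp_linearIsometryEquiv]
    exact ContinuousLinearMap.ext fun x => U.apply_symm_apply x
  have hUU' : adjoint Uc ∘L Uc = 1 := by
    rw [adjoint_comp_linearIsometryEquiv]
    exact ContinuousLinearMap.ext fun x => U.symm_apply_apply x
  refine ⟨?_, fun k hk => h.eq_zero_of_adjoint k ?_, fun z w => ?_⟩
  · have h1 : (T' ∘L adjoint T') ∘L Uc = Uc ∘L (T ∘L adjoint T) :=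
      ContinuousLinearMap.ext fun x => comp_adjoint_apply_of_rowUnitarilyEquivalent hU x
    have h2 : (1 : H' →L[ℂ] H') ∘L Uc = Uc := rfl
    rw [adjoint_comp, comp_assoc, ← comp_assoc (adjoint C), h.adjoint_comp_self, sub_comp, h1,
      comp_sub, ← comp_assoc _ Uc, h2, hUU']
    rfl
  · rw [adjoint_comp, comp_apply] at hk
    have := congrArg Uc hk
    rw [map_zero, ← comp_apply, hUU] at this
    exact this
  · have hC : ∀ z, (C ∘L Uc) ∘L rowResolvent T z = (C ∘L rowResolvent T' z) ∘L Uc := fun z => by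
      rw [comp_assoc, hres, comp_assoc]
    rw [h.one_sub_comp_adjoint, hC, hC, adjoint_comp _ Uc, comp_assoc _ Uc, ← comp_assoc Uc, hUU]
    rfl

end UnitaryEquivalence

/-! ### The CCNC condition as observability. -/

section CommutativeCNC

variable {d : ℕ} {H K : Type*}
  [NormedAddCommGroup H] [InnerProductSpace ℂ H] [CompleteSpace H]
  [NormedAddCommGroup K] [InnerProductSpace ℂ K] [CompleteSpace K]

/-- The orthogonal complement of the span is the intersection of the kernels of `D_{T*} (I - z
T*)⁻¹`, and any `C` with `C* C = D_{T*}²` has the same kernel as `D_{T*}`. -/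
theorem isCCNC_iff {T : Col d H →L[ℂ] H} (hT : ‖T‖ ≤ 1) {C : H →L[ℂ] K}
    (hC : adjoint C ∘L C = 1 - T ∘L adjoint T) :
    IsCCNC T ↔ ∀ h, (∀ z, C (rowResolvent T z h) = 0) → h = 0 := by
  have hmem : ∀ h : H, h ∈ (⨆ z : CBall d, LinearMap.range
      (Ring.inverse (1 - T ∘L adjoint (pointRow H z)) ∘L defect (adjoint T)).toLinearMap)ᗮ ↔
      ∀ z, C (rowResolvent T z h) = 0 := by
    intro h
    rw [← Submodule.iInf_orthogonal, Submodule.mem_iInf]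
    refine forall_congr' fun z => ?_
    have hdef : adjoint C ∘L C = adjoint (defect (adjoint T)) ∘L defect (adjoint T) := by
      rw [hC, adjoint_defect, defect_comp_self (norm_adjoint_le_one hT), adjoint_adjoint]
    rw [comp_eq_zero_iff_of_adjoint_comp_eq hdef, ← adjoint_rowResolvent,
      ContinuousLinearMap.orthogonal_range, LinearMap.mem_ker, adjoint_comp, adjoint_adjoint,
      adjoint_defect]
    rfl
  rw [IsCCNC, Submodule.topologicalClosure_eq_top_iff, Submodule.eq_bot_iff]
  simp only [hmem]

end CommutativeCNC

/-! ### From a Gleason solution to a realization. -/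

section GleasonModel

variable {d : ℕ} {H J K : Type*}
  [NormedAddCommGroup H] [InnerProductSpace ℂ H] [CompleteSpace H]
  [NormedAddCommGroup J] [InnerProductSpace ℂ J] [CompleteSpace J]
  [NormedAddCommGroup K] [InnerProductSpace ℂ K] [CompleteSpace K]
  {T : Col d H →L[ℂ] H} {b : SchurClass d J K}
  {X : Col d (DeBrangesRovnyak b) →L[ℂ] DeBrangesRovnyak b} {U : H ≃ₗᵢ[ℂ] DeBrangesRovnyak b}

theorem pointRow_apply_apply (z : CBall d) (f : Col d (DeBrangesRovnyak b)) (w : CBall d) :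
    (pointRow (DeBrangesRovnyak b) z f) w = ∑ i, z.1 i • (f i) w := by
  rw [pointRow_apply, ← RKHS.adjoint_kerFun, map_sum]
  simp

/-- With `g = (I - z T*)⁻¹ h` one has `h = g - z T* g`, and the Gleason equation evaluates `U z T*
g` at `z` as `(U g)(z) - (U g)(0)`. -/
theorem kerFun_eq_of_isExtremalGleasonSolution (hT : ‖T‖ ≤ 1) (hX : IsExtremalGleasonSolution b X)
    (hU : ∀ h, U (T h) = X (LinearIsometryEquiv.piLpCongrRight 2 (fun _ : Fin d => U) h))
    (z : CBall d) (h : H) : (U h) z = (U (rowResolvent T z h)) (CBall.origin d) := by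
  set g := rowResolvent T z h with hg
  have h1 : g - pointRow H z (adjoint T g) = h := by
    have := congrArg (fun S : H →L[ℂ] H => S h) (one_sub_comp_rowResolvent hT z)
    simpa [← hg] using this
  have h2 := hX.1.1 (U g) z
  rw [← pointRow_apply_apply, pointRow_adjoint_apply_of_rowUnitarilyEquivalent hU] at h2
  rw [← h1, map_sub, RKHS.coe_sub, Pi.sub_apply, h2, sub_sub_cancel]

theorem adjoint_comp_self_of_isExtremalGleasonSolution (hX : IsExtremalGleasonSolution b X)
    (hU : ∀ h, U (T h) = X (LinearIsometryEquiv.piLpCongrRight 2 (fun _ : Fin d => U) h)) :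
    adjoint (adjoint (RKHS.kerFun (DeBrangesRovnyak b) (CBall.origin d)) ∘L
        U.toContinuousLinearEquiv.toContinuousLinearMap) ∘L
      (adjoint (RKHS.kerFun (DeBrangesRovnyak b) (CBall.origin d)) ∘L
        U.toContinuousLinearEquiv.toContinuousLinearMap) = 1 - T ∘L adjoint T := by
  rw [adjoint_comp, adjoint_adjoint, adjoint_comp_linearIsometryEquiv]
  ext h
  have h1 := congrArg (fun S : DeBrangesRovnyak b →L[ℂ] DeBrangesRovnyak b => U.symm (S (U h))) hX.2
  simp only [comp_apply, sub_apply, one_apply_eq_self, map_sub, U.symm_apply_apply,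
    comp_adjoint_apply_of_rowUnitarilyEquivalent hU] at h1
  rw [sub_apply, one_apply_eq_self, comp_apply, comp_apply T, h1, sub_sub_cancel]
  rfl

/-- Evaluating `k₀ k = 0` at the origin gives `k = b(0) b(0)* k`. If `k ≠ 0`, pure contractivity
yields `‖k‖ < ‖b(0)* k‖ ≤ ‖k‖`. This is the dense range condition for `C = k₀* U`. -/
theorem SchurClass.IsPurelyContractive.eq_zero_of_kerFun_origin (hb : b.IsPurelyContractive) (k : K)
    (hk : RKHS.kerFun (DeBrangesRovnyak b) (CBall.origin d) k = 0) : k = 0 := by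
  have h1 : k = b (CBall.origin d) (adjoint (b (CBall.origin d)) k) := by
    have := RKHS.kerFun_apply (DeBrangesRovnyak b) (CBall.origin d) k (CBall.origin d)
    rw [hk, kernel_deBrangesRovnyak] at this
    simp [dBRKernel, CBall.origin] at this
    exact sub_eq_zero.mp this.symm
  by_contra hne
  have hne' : adjoint (b (CBall.origin d)) k ≠ 0 := fun h0 => hne (by rw [h1, h0, map_zero])
  have h2 := hb (CBall.origin d) _ hne'
  rw [← h1] at h2
  have h3 : ‖b (CBall.origin d)‖ ≤ 1 := opNorm_le_bound _ zero_le_one fun x => by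
    rw [one_mul]
    by_cases hx : x = 0
    · simp [hx]
    · exact (hb _ x hx).le
  have h4 := (adjoint (b (CBall.origin d))).le_of_opNorm_le (norm_adjoint_le_one h3) k
  linarith

theorem IsRealization.of_isExtremalGleasonSolution (hT : ‖T‖ ≤ 1) (hb : b.IsPurelyContractive)
    (hX : IsExtremalGleasonSolution b X)
    (hU : ∀ h, U (T h) = X (LinearIsometryEquiv.piLpCongrRight 2 (fun _ : Fin d => U) h)) :
    IsRealization T (adjoint (RKHS.kerFun (DeBrangesRovnyak b) (CBall.origin d)) ∘L
      U.toContinuousLinearEquiv.toContinuousLinearMap) b := by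
  refine ⟨adjoint_comp_self_of_isExtremalGleasonSolution hX hU, fun k hk => ?_, fun z w => ?_⟩
  · rw [adjoint_comp, adjoint_adjoint, adjoint_comp_linearIsometryEquiv] at hk
    refine hb.eq_zero_of_kerFun_origin k ?_
    have : U.symm (RKHS.kerFun (DeBrangesRovnyak b) (CBall.origin d) k) = 0 := hk
    simpa using this
  · have h1 : ∀ z, (adjoint (RKHS.kerFun (DeBrangesRovnyak b) (CBall.origin d)) ∘L
        U.toContinuousLinearEquiv.toContinuousLinearMap) ∘L rowResolvent T z =
        adjoint (RKHS.kerFun (DeBrangesRovnyak b) z) ∘L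
          U.toContinuousLinearEquiv.toContinuousLinearMap := fun z => by
      ext h
      simpa using (kerFun_eq_of_isExtremalGleasonSolution hT hX hU z h).symm
    rw [h1, h1, adjoint_comp, adjoint_adjoint, adjoint_comp_linearIsometryEquiv]
    have h2 := RKHS.kernel_apply (DeBrangesRovnyak b) z w
    rw [kernel_deBrangesRovnyak, dBRKernel, Matrix.of_apply] at h2
    have h3 : (adjoint (RKHS.kerFun (DeBrangesRovnyak b) z) ∘L
        U.toContinuousLinearEquiv.toContinuousLinearMap) ∘L
        (U.symm.toContinuousLinearEquiv.toContinuousLinearMap ∘L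
          RKHS.kerFun (DeBrangesRovnyak b) w) =
        adjoint (RKHS.kerFun (DeBrangesRovnyak b) z) ∘L RKHS.kerFun (DeBrangesRovnyak b) w := by
      ext k
      simp
    rw [h3, ← h2, smul_smul, mul_inv_cancel₀ (one_sub_inner_ne_zero z w), one_smul]

theorem isCCNC_of_isExtremalGleasonSolution (hT : ‖T‖ ≤ 1) (hX : IsExtremalGleasonSolution b X)
    (hU : ∀ h, U (T h) = X (LinearIsometryEquiv.piLpCongrRight 2 (fun _ : Fin d => U) h)) :
    IsCCNC T := by
  refine (isCCNC_iff hT (adjoint_comp_self_of_isExtremalGleasonSolution hX hU)).mpr fun h hh => ?_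
  have h1 : U h = 0 := RKHS.ext fun z => by
    rw [kerFun_eq_of_isExtremalGleasonSolution hT hX hU]
    simpa using hh z
  simpa using h1

end GleasonModel

/-! ### Isometries and range projections. -/

section Isometries

theorem norm_le_one_of_isometry {E F : Type*}
    [NormedAddCommGroup E] [InnerProductSpace ℂ E] [NormedAddCommGroup F] [InnerProductSpace ℂ F]
    {g : E →L[ℂ] F} (hg : Isometry g) : ‖g‖ ≤ 1 :=
  opNorm_le_bound _ zero_le_one fun x => by
    rw [one_mul, (AddMonoidHomClass.isometry_iff_norm g).mp hg]

variable {E F G : Type*}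
  [NormedAddCommGroup E] [InnerProductSpace ℂ E] [CompleteSpace E]
  [NormedAddCommGroup F] [InnerProductSpace ℂ F] [CompleteSpace F]
  [NormedAddCommGroup G] [InnerProductSpace ℂ G]

theorem adjoint_comp_self_of_isometry {g : E →L[ℂ] F} (hg : Isometry g) : adjoint g ∘L g = 1 :=
  g.norm_map_iff_adjoint_comp_self.mp ((AddMonoidHomClass.isometry_iff_norm g).mp hg)

theorem adjoint_comp_comp_of_isometry {g : E →L[ℂ] F} (hg : Isometry g) (A : G →L[ℂ] E) :
    adjoint g ∘L (g ∘L A) = A := by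
  rw [← comp_assoc, adjoint_comp_self_of_isometry hg]
  rfl

variable [CompleteSpace G]

/-- An isometry onto the kernel of a partial isometry `W` has range projection `I - W* W`. -/
theorem comp_adjoint_of_range_eq_ker {g : E →L[ℂ] F} (hg : Isometry g) {W : F →L[ℂ] G}
    (hW : W ∘L adjoint W ∘L W = W)
    (h : LinearMap.range g.toLinearMap = LinearMap.ker W.toLinearMap) :
    g ∘L adjoint g = 1 - adjoint W ∘L W := by
  have h1 : W ∘L g = 0 := by
    ext x
    have : g x ∈ LinearMap.ker W.toLinearMap := h ▸ LinearMap.mem_range_self g.toLinearMap x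
    exact this
  have h2 : adjoint g ∘L adjoint W = 0 := by rw [← adjoint_comp, h1, map_zero]
  ext x
  have h3 : x - adjoint W (W x) ∈ LinearMap.range g.toLinearMap := by
    rw [h, LinearMap.mem_ker]
    change W (x - adjoint W (W x)) = 0
    rw [map_sub, sub_eq_zero]
    exact (congrArg (fun S : F →L[ℂ] G => S x) hW).symm
  obtain ⟨y, hy⟩ := h3
  replace hy : g y = x - adjoint W (W x) := hy
  have h4 : adjoint g (g y) = y :=
    congrArg (fun S : E →L[ℂ] E => S y) (adjoint_comp_self_of_isometry hg)
  have h5 : adjoint g (adjoint W (W x)) = 0 := congrArg (fun S : G →L[ℂ] E => S (W x)) h2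
  rw [hy, map_sub, h5, sub_zero] at h4
  simp only [comp_apply, sub_apply, one_apply_eq_self]
  rw [h4, hy]

end Isometries

/-! ### The partial isometric part of a row contraction. -/

section IsometricPart

variable {d : ℕ} {H : Type*} [NormedAddCommGroup H] [InnerProductSpace ℂ H] [CompleteSpace H]
  {T : Col d H →L[ℂ] H}

/-- The projection onto `ker D_T`. -/
noncomputable def defectKerProj (T : Col d H →L[ℂ] H) : Col d H →L[ℂ] Col d H :=
  (LinearMap.ker (defect T).toLinearMap).starProjection

theorem isometricPart_eq (T : Col d H →L[ℂ] H) : isometricPart T = T ∘L defectKerProj T := rfl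

theorem adjoint_defectKerProj (T : Col d H →L[ℂ] H) :
    adjoint (defectKerProj T) = defectKerProj T :=
  (isSelfAdjoint_starProjection _).star_eq

theorem defectKerProj_comp_self (T : Col d H →L[ℂ] H) :
    defectKerProj T ∘L defectKerProj T = defectKerProj T :=
  Submodule.isIdempotentElem_starProjection _

theorem defectKerProj_apply_eq_self (hT : ‖T‖ ≤ 1) {x : Col d H} (h : adjoint T (T x) = x) :
    defectKerProj T x = x :=
  Submodule.starProjection_eq_self_iff.mpr ((defect_apply_eq_zero_iff hT x).mpr h)

theorem adjoint_comp_comp_defectKerProj (hT : ‖T‖ ≤ 1) :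
    adjoint T ∘L T ∘L defectKerProj T = defectKerProj T := by
  ext1 x
  have h : defectKerProj T x ∈ LinearMap.ker (defect T).toLinearMap :=
    Submodule.starProjection_apply_mem _ x
  exact (defect_apply_eq_zero_iff hT _).mp h

theorem adjoint_isometricPart (T : Col d H →L[ℂ] H) :
    adjoint (isometricPart T) = defectKerProj T ∘L adjoint T := by
  rw [isometricPart_eq, adjoint_comp, adjoint_defectKerProj]

/-- This is the adjoint of `T* T P = P`, with `P` the projection onto `ker D_T`. It implies that `T`
maps `ker V` into `ker V*`. -/
theorem adjoint_isometricPart_comp (hT : ‖T‖ ≤ 1) :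
    adjoint (isometricPart T) ∘L T = defectKerProj T := by
  have := congrArg adjoint (adjoint_comp_comp_defectKerProj hT)
  rwa [adjoint_comp, adjoint_comp, adjoint_adjoint, adjoint_defectKerProj,
    ← adjoint_isometricPart] at this

theorem adjoint_isometricPart_comp_self (hT : ‖T‖ ≤ 1) :
    adjoint (isometricPart T) ∘L isometricPart T = defectKerProj T := by
  rw [isometricPart_eq, ← comp_assoc, ← isometricPart_eq, adjoint_isometricPart_comp hT,
    defectKerProj_comp_self]

theorem isometricPart_comp_adjoint (T : Col d H →L[ℂ] H) :
    isometricPart T ∘L adjoint (isometricPart T) = T ∘L defectKerProj T ∘L adjoint T := by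
  rw [adjoint_isometricPart, isometricPart_eq, comp_assoc, ← comp_assoc (defectKerProj T),
    defectKerProj_comp_self]

theorem isometricPart_comp_adjoint_comp_self (hT : ‖T‖ ≤ 1) :
    isometricPart T ∘L adjoint (isometricPart T) ∘L isometricPart T = isometricPart T := by
  rw [adjoint_isometricPart_comp_self hT, isometricPart_eq, comp_assoc, defectKerProj_comp_self]

theorem norm_isometricPart_le (hT : ‖T‖ ≤ 1) : ‖isometricPart T‖ ≤ 1 := by
  refine opNorm_le_bound _ zero_le_one fun x => ?_
  rw [one_mul, isometricPart_eq, comp_apply]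
  refine (T.le_of_opNorm_le hT _).trans ?_
  rw [one_mul]
  exact Submodule.norm_starProjection_apply_le _ x

end IsometricPart

/-! ### The subspaces `(Ran (V - z) V* V)ᗮ`. -/

section RestrictedRange

variable {d : ℕ} {H : Type*} [NormedAddCommGroup H] [InnerProductSpace ℂ H] [CompleteSpace H]
  {V : Col d H →L[ℂ] H}

theorem adjoint_comp_comp_adjoint_of_partialIsometry (hV : V ∘L adjoint V ∘L V = V) :
    adjoint V ∘L V ∘L adjoint V = adjoint V := by
  have := congrArg adjoint hV
  rwa [adjoint_comp, adjoint_comp, adjoint_adjoint, comp_assoc] at this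

/-- Since `V* V V* = V*`, the adjoint of `(V - z) V* V` is `V* (I - V z*)`. The complement is
therefore `(I - V z*)⁻¹ ker V*` when `V` is a contraction. -/
theorem mem_orthogonal_restrictedRange (hV : V ∘L adjoint V ∘L V = V) (z : CBall d) (x : H) :
    x ∈ (restrictedRange V z)ᗮ ↔ adjoint V ((1 - V ∘L adjoint (pointRow H z)) x) = 0 := by
  rw [restrictedRange, ContinuousLinearMap.orthogonal_range, LinearMap.mem_ker]
  have h1 : adjoint ((V - pointRow H z) ∘L adjoint V ∘L V) =
      adjoint V ∘L (1 - V ∘L adjoint (pointRow H z)) := by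
    rw [adjoint_comp, adjoint_comp, adjoint_adjoint, map_sub, comp_sub, comp_sub, comp_assoc,
      adjoint_comp_comp_adjoint_of_partialIsometry hV]
    rfl
  rw [h1]
  rfl

theorem restrictedRange_origin_orthogonal (hV : V ∘L adjoint V ∘L V = V) :
    (restrictedRange V (CBall.origin d))ᗮ = LinearMap.ker (adjoint V).toLinearMap := by
  ext x
  rw [mem_orthogonal_restrictedRange hV, pointRow_origin]
  simp

theorem one_sub_comp_adjoint_rowResolvent (hV : ‖V‖ ≤ 1) (z : CBall d) :
    (1 - V ∘L adjoint (pointRow H z)) ∘L adjoint (rowResolvent V z) = 1 := by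
  have := congrArg adjoint (rowResolvent_comp_one_sub hV z)
  rwa [adjoint_comp, map_sub, adjoint_comp, adjoint_adjoint, adjoint_one] at this

theorem adjoint_rowResolvent_comp_one_sub (hV : ‖V‖ ≤ 1) (z : CBall d) :
    adjoint (rowResolvent V z) ∘L (1 - V ∘L adjoint (pointRow H z)) = 1 := by
  have := congrArg adjoint (one_sub_comp_rowResolvent hV z)
  rwa [adjoint_comp, map_sub, adjoint_comp, adjoint_adjoint, adjoint_one] at this

end RestrictedRange

/-! ### Resolvent formula for the characteristic function of a partial isometry. -/

namespace ModelTriple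

variable {d : ℕ} {H Jinf J0 : Type*}
  [NormedAddCommGroup H] [InnerProductSpace ℂ H] [CompleteSpace H]
  [NormedAddCommGroup Jinf] [InnerProductSpace ℂ Jinf] [CompleteSpace Jinf]
  [NormedAddCommGroup J0] [InnerProductSpace ℂ J0] [CompleteSpace J0]
  {V : Col d H →L[ℂ] H} (γ : ModelTriple V Jinf J0)

theorem range_map_origin (hV : V ∘L adjoint V ∘L V = V) :
    LinearMap.range (γ.map (CBall.origin d)).toLinearMap =
      LinearMap.ker (adjoint V).toLinearMap := by
  rw [γ.range_map, restrictedRange_origin_orthogonal hV]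

theorem map_origin_comp_adjoint (hV : V ∘L adjoint V ∘L V = V) :
    γ.map (CBall.origin d) ∘L adjoint (γ.map (CBall.origin d)) = 1 - V ∘L adjoint V := by
  have := comp_adjoint_of_range_eq_ker γ.isometry_map_origin (W := adjoint V)
    (by rw [adjoint_adjoint, adjoint_comp_comp_adjoint_of_partialIsometry hV])
    (γ.range_map_origin hV)
  rwa [adjoint_adjoint] at this

theorem mapInf_comp_adjoint (hV : V ∘L adjoint V ∘L V = V) :
    γ.mapInf ∘L adjoint γ.mapInf = 1 - adjoint V ∘L V :=
  comp_adjoint_of_range_eq_ker γ.isometry_mapInf hV γ.range_mapInf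

theorem adjoint_comp_map_origin (hV : V ∘L adjoint V ∘L V = V) :
    adjoint V ∘L γ.map (CBall.origin d) = 0 := by
  ext1 x
  have : γ.map (CBall.origin d) x ∈ LinearMap.ker (adjoint V).toLinearMap :=
    γ.range_map_origin hV ▸ LinearMap.mem_range_self (γ.map (CBall.origin d)).toLinearMap x
  exact this

theorem comp_mapInf : V ∘L γ.mapInf = 0 := by
  ext1 x
  have : γ.mapInf x ∈ LinearMap.ker V.toLinearMap :=
    γ.range_mapInf ▸ LinearMap.mem_range_self γ.mapInf.toLinearMap x
  exact this

theorem adjoint_map_origin_comp (hV : V ∘L adjoint V ∘L V = V) :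
    adjoint (γ.map (CBall.origin d)) ∘L V = 0 := by
  have := congrArg adjoint (γ.adjoint_comp_map_origin hV)
  rwa [adjoint_comp, adjoint_adjoint, map_zero] at this

/-- The left side takes values in `ker V*`, the range of `γ(0)`, so it equals `γ(0) γ(0)*` times
itself; and `γ(0)* V = 0` reduces the inner factor to `γ(0)* γ(z)`. -/
theorem one_sub_comp_map (hV : V ∘L adjoint V ∘L V = V) (z : CBall d) :
    (1 - V ∘L adjoint (pointRow H z)) ∘L γ.map z =
      γ.map (CBall.origin d) ∘L adjoint (γ.denom z) := by
  rw [denom, adjoint_comp, adjoint_adjoint]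
  set g := γ.map (CBall.origin d) with hg
  have h1 : adjoint g ∘L (1 - V ∘L adjoint (pointRow H z)) = adjoint g := by
    rw [comp_sub, ← comp_assoc, γ.adjoint_map_origin_comp hV, zero_comp, sub_zero]
    rfl
  have h2 : adjoint V ∘L (1 - V ∘L adjoint (pointRow H z)) ∘L γ.map z = 0 := by
    ext1 m
    have : γ.map z m ∈ (restrictedRange V z)ᗮ :=
      γ.range_map z ▸ LinearMap.mem_range_self (γ.map z).toLinearMap m
    exact (mem_orthogonal_restrictedRange hV z _).mp this
  calc (1 - V ∘L adjoint (pointRow H z)) ∘L γ.map z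
      = (g ∘L adjoint g + V ∘L adjoint V) ∘L (1 - V ∘L adjoint (pointRow H z)) ∘L γ.map z := by
        rw [γ.map_origin_comp_adjoint hV, sub_add_cancel]
        rfl
    _ = g ∘L (adjoint g ∘L (1 - V ∘L adjoint (pointRow H z))) ∘L γ.map z := by
        rw [add_comp, comp_assoc V, h2, comp_zero, add_zero]
        rfl
    _ = _ := by rw [h1]

/-- `I - V z*` is invertible and carries the range of `γ(z)` onto that of `γ(0)`, so
`one_sub_comp_map` makes `D(z)*` bijective. -/
theorem isUnit_denom (hV : V ∘L adjoint V ∘L V = V) (hV1 : ‖V‖ ≤ 1) (z : CBall d) :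
    IsUnit (γ.denom z) := by
  have h : IsUnit (adjoint (γ.denom z)) := by
    refine ContinuousLinearMap.isUnit_iff_bijective.mpr ⟨?_, fun k => ?_⟩
    · refine (injective_iff_map_eq_zero _).mpr fun m hm => ?_
      have h1 := congrArg (fun S : J0 →L[ℂ] H => adjoint (rowResolvent V z) (S m))
        (γ.one_sub_comp_map hV z)
      have h2 := congrArg (fun S : H →L[ℂ] H => S (γ.map z m))
        (adjoint_rowResolvent_comp_one_sub hV1 z)
      simp only [comp_apply, one_apply_eq_self, hm, map_zero] at h1 h2
      rw [h1] at h2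
      exact (injective_iff_map_eq_zero _).mp (γ.injective_map z) m h2.symm
    · have h1 := congrArg (fun S : H →L[ℂ] H => S (γ.map (CBall.origin d) k))
        (one_sub_comp_adjoint_rowResolvent hV1 z)
      have h2 : adjoint (rowResolvent V z) (γ.map (CBall.origin d) k) ∈
          LinearMap.range (γ.map z).toLinearMap := by
        rw [γ.range_map, mem_orthogonal_restrictedRange hV, ← comp_apply (1 - _), h1]
        exact congrArg (fun S : J0 →L[ℂ] Col d H => S k) (γ.adjoint_comp_map_origin hV)
      obtain ⟨m, hm⟩ := h2
      replace hm : γ.map z m = _ := hm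
      refine ⟨m, γ.isometry_map_origin.injective ?_⟩
      have h3 := congrArg (fun S : J0 →L[ℂ] H => S m) (γ.one_sub_comp_map hV z)
      simp only [comp_apply] at h3
      rw [← h3, hm]
      exact h1
  have := h.star
  rwa [star_eq_adjoint, adjoint_adjoint] at this

/-- `b_V(z) = γ(0)* (I - z V*)⁻¹ z γ(∞)`. -/
theorem charFun_eq (hV : V ∘L adjoint V ∘L V = V) (hV1 : ‖V‖ ≤ 1) (z : CBall d) :
    γ.charFun z = adjoint (γ.map (CBall.origin d)) ∘L rowResolvent V z ∘L
      pointRow H z ∘L γ.mapInf := by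
  have h1 : adjoint (γ.map z) =
      γ.denom z ∘L adjoint (γ.map (CBall.origin d)) ∘L rowResolvent V z := by
    have := congrArg (fun S : J0 →L[ℂ] H => adjoint (adjoint (rowResolvent V z) ∘L S))
      (γ.one_sub_comp_map hV z)
    simp only [← comp_assoc, adjoint_rowResolvent_comp_one_sub hV1] at this
    rw [adjoint_comp, adjoint_one, adjoint_comp _ (adjoint _), adjoint_adjoint, adjoint_comp,
      adjoint_adjoint] at this
    exact this
  rw [charFun, numer, ← comp_assoc (pointRow J0 z), pointRow_ampliation, h1]
  have h2 : Ring.inverse (γ.denom z) ∘L γ.denom z = 1 :=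
    Ring.inverse_mul_cancel _ (γ.isUnit_denom hV hV1 z)
  simp only [comp_assoc]
  rw [← comp_assoc (Ring.inverse _), h2]
  rfl

end ModelTriple

/-! ### Existence of a model triple. -/

section ModelTripleExistence

variable {d : ℕ} {H : Type u} [NormedAddCommGroup H] [InnerProductSpace ℂ H] [CompleteSpace H]
  {V : Col d H →L[ℂ] H}

/-- The model triple `γ(z) = (I - V z*)⁻¹` on `(Ran V)ᗮ`, with `γ(∞)` the inclusion of `ker V`. -/
noncomputable def ModelTriple.canonical (hV : V ∘L adjoint V ∘L V = V) (hV1 : ‖V‖ ≤ 1) :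
    ModelTriple V (LinearMap.ker V.toLinearMap) (LinearMap.ker (adjoint V).toLinearMap) where
  map z := adjoint (rowResolvent V z) ∘L (LinearMap.ker (adjoint V).toLinearMap).subtypeL
  mapInf := (LinearMap.ker V.toLinearMap).subtypeL
  injective_map z := by
    have h : Function.LeftInverse (1 - V ∘L adjoint (pointRow H z) : H →L[ℂ] H)
        (adjoint (rowResolvent V z)) := fun x =>
      congrArg (fun S : H →L[ℂ] H => S x) (one_sub_comp_adjoint_rowResolvent hV1 z)
    exact h.injective.comp Subtype.val_injective
  range_map z := by
    ext x
    rw [mem_orthogonal_restrictedRange hV]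
    constructor
    · rintro ⟨k, rfl⟩
      have h : (1 - V ∘L adjoint (pointRow H z)) (adjoint (rowResolvent V z) k) = k :=
        congrArg (fun S : H →L[ℂ] H => S k) (one_sub_comp_adjoint_rowResolvent hV1 z)
      exact (congrArg (adjoint V) h).trans k.2
    · intro hx
      have h : adjoint (rowResolvent V z) ((1 - V ∘L adjoint (pointRow H z)) x) = x :=
        congrArg (fun S : H →L[ℂ] H => S x) (adjoint_rowResolvent_comp_one_sub hV1 z)
      exact ⟨⟨_, LinearMap.mem_ker.mpr hx⟩, h⟩
  isometry_map_origin := by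
    rw [rowResolvent_origin, adjoint_one]
    exact isometry_subtype_coe
  isometry_mapInf := isometry_subtype_coe
  range_mapInf := by
    ext x
    exact ⟨fun ⟨k, hk⟩ => hk ▸ k.2, fun hx => ⟨⟨x, hx⟩, rfl⟩⟩

end ModelTripleExistence

/-! ### Transfer functions of colligations. -/

section Colligation

variable {d : ℕ} {H J K : Type*}
  [NormedAddCommGroup H] [InnerProductSpace ℂ H] [CompleteSpace H]
  [NormedAddCommGroup J] [InnerProductSpace ℂ J] [CompleteSpace J]
  [NormedAddCommGroup K] [InnerProductSpace ℂ K] [CompleteSpace K]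

/-- The transfer function `D + C (I - z T*)⁻¹ z B` of the colligation `[T*, B; C, D]`. -/
noncomputable def transferFunction (T : Col d H →L[ℂ] H) (B : J →L[ℂ] Col d H) (C : H →L[ℂ] K)
    (D : J →L[ℂ] K) (z : CBall d) : J →L[ℂ] K :=
  D + C ∘L rowResolvent T z ∘L pointRow H z ∘L B

variable {T : Col d H →L[ℂ] H} {B : J →L[ℂ] Col d H} {C : H →L[ℂ] K} {D : J →L[ℂ] K}

/-- The hypotheses say that `[T*, B; C, D]` is a coisometry. With `L(z) = C (I - z T*)⁻¹ z`, the
product expands in `B B*`, `B D*`, `D D*`, and `L(z) T* = C (I - z T*)⁻¹ - C` collapses the terms.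
-/
theorem one_sub_transferFunction_comp_adjoint (hT : ‖T‖ ≤ 1)
    (h₁ : B ∘L adjoint B = 1 - adjoint T ∘L T) (h₂ : B ∘L adjoint D = -(adjoint T ∘L adjoint C))
    (h₃ : C ∘L adjoint C + D ∘L adjoint D = 1) (z w : CBall d) :
    1 - transferFunction T B C D z ∘L adjoint (transferFunction T B C D w) =
      (1 - inner ℂ w.1 z.1 : ℂ) •
        ((C ∘L rowResolvent T z) ∘L adjoint (C ∘L rowResolvent T w)) := by
  set L : CBall d → Col d H →L[ℂ] K := fun z => (C ∘L rowResolvent T z) ∘L pointRow H z with hL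
  have hc : ∀ z, transferFunction T B C D z = D + L z ∘L B := fun z => rfl
  have hLT : ∀ z, L z ∘L adjoint T = C ∘L rowResolvent T z - C := fun z => by
    have h := rowResolvent_comp_one_sub hT z
    rw [comp_sub, sub_eq_iff_eq_add] at h
    have h' : rowResolvent T z ∘L pointRow H z ∘L adjoint T = rowResolvent T z - 1 :=
      eq_sub_of_add_eq' h.symm
    simp only [hL]
    rw [comp_assoc, comp_assoc, h', comp_sub]
    rfl
  have hTL : ∀ z, T ∘L adjoint (L z) = adjoint (C ∘L rowResolvent T z) - adjoint C := fun z => by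
    have := congrArg adjoint (hLT z)
    rwa [adjoint_comp, adjoint_adjoint, map_sub] at this
  have hLL : L z ∘L adjoint (L w) = (inner ℂ w.1 z.1 : ℂ) •
      ((C ∘L rowResolvent T z) ∘L adjoint (C ∘L rowResolvent T w)) := by
    simp only [hL]
    rw [adjoint_comp _ (pointRow H w), comp_assoc, ← comp_assoc (pointRow H z),
      pointRow_comp_adjoint, smul_comp, comp_smul]
    rfl
  have h₂' : D ∘L adjoint B = -(C ∘L T) := by
    have := congrArg adjoint h₂
    rwa [adjoint_comp, adjoint_adjoint, map_neg, adjoint_comp, adjoint_adjoint,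
      adjoint_adjoint] at this
  have hexp : transferFunction T B C D z ∘L adjoint (transferFunction T B C D w) =
      D ∘L adjoint D + (D ∘L adjoint B) ∘L adjoint (L w) + L z ∘L (B ∘L adjoint D) +
        L z ∘L (B ∘L adjoint B) ∘L adjoint (L w) := by
    rw [hc, hc, map_add, adjoint_comp, comp_add, add_comp, add_comp]
    simp only [comp_assoc]
    abel
  have h4 : L z ∘L (adjoint T ∘L T) ∘L adjoint (L w) =
      (C ∘L rowResolvent T z - C) ∘L (adjoint (C ∘L rowResolvent T w) - adjoint C) := by
    rw [← hLT, ← hTL]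
    simp only [comp_assoc]
  have h5 : D ∘L adjoint D = 1 - C ∘L adjoint C := eq_sub_of_add_eq' h₃
  have h6 : L z ∘L (1 : Col d H →L[ℂ] Col d H) ∘L adjoint (L w) = L z ∘L adjoint (L w) := rfl
  rw [hexp, h₁, h₂, h₂', sub_comp, comp_sub, h4, h6, hLL, h5, neg_comp, comp_neg, comp_assoc,
    hTL, ← comp_assoc (L z), hLT, sub_smul, one_smul]
  simp only [comp_sub, sub_comp]
  abel

/-- Here the colligation is an isometry, so energy balances: `‖x'‖² + ‖y‖² = ‖x‖² + ‖u‖²` with `y`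
the output, `x' = T* x + B u` and `x = z x'`. As `‖z‖ < 1`, no strict loss from `u` to `y` would
force `x' = x = 0` and `B u = 0`. -/
theorem norm_transferFunction_apply_lt (hT : ‖T‖ ≤ 1)
    (h₁ : T ∘L adjoint T + adjoint C ∘L C = 1) (h₂ : T ∘L B + adjoint C ∘L D = 0)
    (h₃ : adjoint B ∘L B + adjoint D ∘L D = 1) (hB : Function.Injective B) (z : CBall d) {u : J}
    (hu : u ≠ 0) : ‖transferFunction T B C D z u‖ < ‖u‖ := by
  set x := rowResolvent T z (pointRow H z (B u)) with hx
  set x' := adjoint T x + B u with hx'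
  have hzx : pointRow H z x' = x := by
    have := congrArg (fun S : H →L[ℂ] H => S (pointRow H z (B u))) (one_sub_comp_rowResolvent hT z)
    simp only [comp_apply, sub_apply, one_apply_eq_self, ← hx] at this
    rw [hx', map_add, ← this]
    abel
  have hy : transferFunction T B C D z u = C x + D u := by
    rw [hx, add_comm]
    rfl
  rw [hy]
  have key : (inner ℂ x' x' : ℂ) + inner ℂ (C x + D u) (C x + D u) = inner ℂ x x + inner ℂ u u := by
    have e₁ : (inner ℂ (adjoint T x) (adjoint T x) : ℂ) + inner ℂ (C x) (C x) = inner ℂ x x := by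
      rw [← adjoint_inner_right C, adjoint_inner_left, ← inner_add_right]
      exact congrArg (fun S : H →L[ℂ] H => inner ℂ x (S x)) h₁
    have e₂ : (inner ℂ (adjoint T x) (B u) : ℂ) + inner ℂ (C x) (D u) = 0 := by
      rw [← adjoint_inner_right C, adjoint_inner_left, ← inner_add_right]
      exact (congrArg (fun S : J →L[ℂ] H => inner ℂ x (S u)) h₂).trans (inner_zero_right _)
    have e₂' : (inner ℂ (B u) (adjoint T x) : ℂ) + inner ℂ (D u) (C x) = 0 := by
      have := congrArg (starRingEnd ℂ) e₂
      rwa [map_add, inner_conj_symm, inner_conj_symm, map_zero] at this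
    have e₃ : (inner ℂ (B u) (B u) : ℂ) + inner ℂ (D u) (D u) = inner ℂ u u := by
      rw [← adjoint_inner_right B, ← adjoint_inner_right D, ← inner_add_right]
      exact congrArg (fun S : J →L[ℂ] J => inner ℂ u (S u)) h₃
    rw [hx']
    simp only [inner_add_left, inner_add_right]
    linear_combination e₁ + e₂ + e₂' + e₃
  simp only [inner_self_eq_norm_sq_to_K] at key
  have key' : ‖x'‖ ^ 2 + ‖C x + D u‖ ^ 2 = ‖x‖ ^ 2 + ‖u‖ ^ 2 := by exact_mod_cast key
  have hle : ‖x‖ ≤ ‖pointRow H z‖ * ‖x'‖ := hzx ▸ (pointRow H z).le_opNorm x'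
  by_contra! hcon
  have hx0 : ‖x'‖ ≤ ‖x‖ := by
    refine (sq_le_sq₀ (norm_nonneg _) (norm_nonneg _)).mp ?_
    have : ‖u‖ ^ 2 ≤ ‖C x + D u‖ ^ 2 := by gcongr
    linarith
  have hx'0 : x' = 0 := by
    rw [← norm_eq_zero]
    nlinarith [norm_nonneg x', norm_pointRow_lt_one (H := H) z]
  have hx00 : x = 0 := by rw [← hzx, hx'0, map_zero]
  rw [hx', hx00, map_zero, zero_add] at hx'0
  exact hu (hB (hx'0.trans (map_zero B).symm))

end Colligation

/-! ### The zero-point contraction and the unitary colligation it defines. -/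

section ZeroPoint

variable {d : ℕ} {H Jinf J0 : Type*}
  [NormedAddCommGroup H] [InnerProductSpace ℂ H] [CompleteSpace H]
  [NormedAddCommGroup Jinf] [InnerProductSpace ℂ Jinf] [CompleteSpace Jinf]
  [NormedAddCommGroup J0] [InnerProductSpace ℂ J0] [CompleteSpace J0]
  {T : Col d H →L[ℂ] H}

theorem defectKerProj_comp_mapInf (hT : ‖T‖ ≤ 1) (γ : ModelTriple (isometricPart T) Jinf J0) :
    defectKerProj T ∘L γ.mapInf = 0 := by
  rw [← adjoint_isometricPart_comp_self hT, comp_assoc, γ.comp_mapInf, comp_zero]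

theorem mapInf_comp_adjoint_mapInf (hT : ‖T‖ ≤ 1) (γ : ModelTriple (isometricPart T) Jinf J0) :
    γ.mapInf ∘L adjoint γ.mapInf = 1 - defectKerProj T := by
  rw [γ.mapInf_comp_adjoint (isometricPart_comp_adjoint_comp_self hT),
    adjoint_isometricPart_comp_self hT]

theorem norm_zeroPoint_le (hT : ‖T‖ ≤ 1) (γ : ModelTriple (isometricPart T) Jinf J0) :
    ‖zeroPoint T γ‖ ≤ 1 := by
  have h0 := norm_adjoint_le_one (norm_le_one_of_isometry γ.isometry_map_origin)
  have h1 := norm_le_one_of_isometry γ.isometry_mapInf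
  have h2 : ‖T ∘L γ.mapInf‖ ≤ 1 :=
    (opNorm_comp_le _ _).trans (mul_le_one₀ hT (norm_nonneg _) h1)
  rw [zeroPoint, norm_neg]
  exact (opNorm_comp_le _ _).trans (mul_le_one₀ h0 (norm_nonneg _) h2)

/-- `γ(0) γ(0)* = I - V V*` and `V* T γ(∞) = 0`, so compressing `T γ(∞)` to `ker V*` loses nothing.
-/
theorem map_origin_comp_zeroPoint (hT : ‖T‖ ≤ 1) (γ : ModelTriple (isometricPart T) Jinf J0) :
    γ.map (CBall.origin d) ∘L zeroPoint T γ = -(T ∘L γ.mapInf) := by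
  rw [zeroPoint, comp_neg, ← comp_assoc,
    γ.map_origin_comp_adjoint (isometricPart_comp_adjoint_comp_self hT), sub_comp, comp_assoc,
    ← comp_assoc (adjoint _) T, adjoint_isometricPart_comp hT,
    defectKerProj_comp_mapInf hT γ, comp_zero, sub_zero]
  rfl

theorem mapInf_comp_adjoint_zeroPoint (hT : ‖T‖ ≤ 1) (γ : ModelTriple (isometricPart T) Jinf J0) :
    γ.mapInf ∘L adjoint (zeroPoint T γ) = -(adjoint T ∘L γ.map (CBall.origin d)) := by
  have h : defectKerProj T ∘L adjoint T ∘L γ.map (CBall.origin d) = 0 := by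
    rw [← comp_assoc, ← adjoint_isometricPart,
      γ.adjoint_comp_map_origin (isometricPart_comp_adjoint_comp_self hT)]
  rw [zeroPoint, map_neg, adjoint_comp, adjoint_comp, adjoint_adjoint, comp_neg, comp_assoc,
    ← comp_assoc, mapInf_comp_adjoint_mapInf hT, sub_comp, h, sub_zero]
  rfl

/-- `T = V - γ(0) δ γ(∞)*`. -/
theorem eq_isometricPart_sub (hT : ‖T‖ ≤ 1) (γ : ModelTriple (isometricPart T) Jinf J0) :
    T = isometricPart T - γ.map (CBall.origin d) ∘L zeroPoint T γ ∘L adjoint γ.mapInf := by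
  rw [← comp_assoc, map_origin_comp_zeroPoint hT, neg_comp, comp_assoc,
    mapInf_comp_adjoint_mapInf hT, comp_sub, isometricPart_eq, sub_neg_eq_add, add_sub_cancel]
  rfl

theorem map_origin_comp_one_sub_zeroPoint (hT : ‖T‖ ≤ 1)
    (γ : ModelTriple (isometricPart T) Jinf J0) :
    γ.map (CBall.origin d) ∘L (1 - zeroPoint T γ ∘L adjoint (zeroPoint T γ)) ∘L
      adjoint (γ.map (CBall.origin d)) = 1 - T ∘L adjoint T := by
  have h1 : adjoint (zeroPoint T γ) ∘L adjoint (γ.map (CBall.origin d)) =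
      -(adjoint γ.mapInf ∘L adjoint T) := by
    rw [← adjoint_comp, map_origin_comp_zeroPoint hT, map_neg, adjoint_comp]
  have h2 : γ.map (CBall.origin d) ∘L (1 : J0 →L[ℂ] J0) ∘L adjoint (γ.map (CBall.origin d)) =
      1 - isometricPart T ∘L adjoint (isometricPart T) :=
    γ.map_origin_comp_adjoint (isometricPart_comp_adjoint_comp_self hT)
  rw [sub_comp, comp_sub, h2, comp_assoc, h1, ← comp_assoc, map_origin_comp_zeroPoint hT,
    neg_comp, comp_neg, neg_neg, comp_assoc, ← comp_assoc γ.mapInf, mapInf_comp_adjoint_mapInf hT,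
    isometricPart_comp_adjoint, sub_comp, comp_sub, sub_sub, add_sub_cancel]
  rfl

theorem mapInf_comp_one_sub_zeroPoint (hT : ‖T‖ ≤ 1)
    (γ : ModelTriple (isometricPart T) Jinf J0) :
    γ.mapInf ∘L (1 - adjoint (zeroPoint T γ) ∘L zeroPoint T γ) ∘L adjoint γ.mapInf =
      1 - adjoint T ∘L T := by
  have h1 : zeroPoint T γ ∘L adjoint γ.mapInf =
      -(adjoint (γ.map (CBall.origin d)) ∘L T) := by
    have := congrArg adjoint (mapInf_comp_adjoint_zeroPoint hT γ)
    rwa [adjoint_comp, adjoint_adjoint, map_neg, adjoint_comp, adjoint_adjoint] at this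
  have h2 : γ.mapInf ∘L (1 : Jinf →L[ℂ] Jinf) ∘L adjoint γ.mapInf = 1 - defectKerProj T :=
    mapInf_comp_adjoint_mapInf hT γ
  have h3 : (isometricPart T ∘L adjoint (isometricPart T)) ∘L T = T ∘L defectKerProj T := by
    rw [comp_assoc, adjoint_isometricPart_comp hT, isometricPart_eq, comp_assoc,
      defectKerProj_comp_self]
  rw [sub_comp, comp_sub, h2, comp_assoc, h1, ← comp_assoc, mapInf_comp_adjoint_zeroPoint hT,
    neg_comp, comp_neg, neg_neg, comp_assoc, ← comp_assoc (γ.map _),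
    γ.map_origin_comp_adjoint (isometricPart_comp_adjoint_comp_self hT), sub_comp, h3, comp_sub,
    adjoint_comp_comp_defectKerProj hT, sub_sub, add_sub_cancel]
  rfl

/-- If `δ δ* k = k`, then `T T*` fixes `γ(0) k`, so `T* γ(0) k` lies in `ker D_T`. Its projection
there is `V* γ(0) k = 0`, hence `γ(0) k = 0`. -/
theorem eq_zero_of_defect_adjoint_zeroPoint (hT : ‖T‖ ≤ 1)
    (γ : ModelTriple (isometricPart T) Jinf J0) {k : J0}
    (hk : defect (adjoint (zeroPoint T γ)) k = 0) : k = 0 := by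
  have h1 := (defect_apply_eq_zero_iff (norm_adjoint_le_one (norm_zeroPoint_le hT γ)) k).mp hk
  rw [adjoint_adjoint] at h1
  set g := γ.map (CBall.origin d) with hg
  have h2 : T (adjoint T (g k)) = g k := by
    have e₁ := congrArg (fun S : Jinf →L[ℂ] H => S (adjoint (zeroPoint T γ) k))
      (map_origin_comp_zeroPoint hT γ)
    have e₂ := congrArg (fun S : J0 →L[ℂ] Col d H => T (S k)) (mapInf_comp_adjoint_zeroPoint hT γ)
    simp only [comp_apply, neg_apply, h1, map_neg] at e₁ e₂
    rw [e₂, neg_neg] at e₁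
    exact e₁.symm
  have h3 : defectKerProj T (adjoint T (g k)) = adjoint T (g k) :=
    defectKerProj_apply_eq_self hT (by rw [h2])
  have h4 : defectKerProj T (adjoint T (g k)) = 0 := by
    rw [← comp_apply, ← adjoint_isometricPart]
    exact congrArg (fun S : J0 →L[ℂ] Col d H => S k)
      (γ.adjoint_comp_map_origin (isometricPart_comp_adjoint_comp_self hT))
  rw [← h3, h4, map_zero] at h2
  exact γ.isometry_map_origin.injective (h2.symm.trans (map_zero _).symm)

theorem eq_zero_of_defect_zeroPoint (hT : ‖T‖ ≤ 1)
    (γ : ModelTriple (isometricPart T) Jinf J0) {u : Jinf}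
    (hu : defect (zeroPoint T γ) u = 0) : u = 0 := by
  have h1 := (defect_apply_eq_zero_iff (norm_zeroPoint_le hT γ) u).mp hu
  have h2 : adjoint T (T (γ.mapInf u)) = γ.mapInf u := by
    have e₁ := congrArg (fun S : J0 →L[ℂ] Col d H => S (zeroPoint T γ u))
      (mapInf_comp_adjoint_zeroPoint hT γ)
    have e₂ := congrArg (fun S : Jinf →L[ℂ] H => adjoint T (S u)) (map_origin_comp_zeroPoint hT γ)
    simp only [comp_apply, neg_apply, h1, map_neg] at e₁ e₂
    rw [e₂, neg_neg] at e₁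
    exact e₁.symm
  have h3 := defectKerProj_apply_eq_self hT h2
  rw [← comp_apply, defectKerProj_comp_mapInf hT γ] at h3
  exact γ.isometry_mapInf.injective (h3.symm.trans (map_zero _).symm)

/-- `D_{δ*} γ(0)*`, a factor of `I - T T*`. -/
noncomputable def outputMap (T : Col d H →L[ℂ] H) (γ : ModelTriple (isometricPart T) Jinf J0) :
    H →L[ℂ] J0 :=
  defect (adjoint (zeroPoint T γ)) ∘L adjoint (γ.map (CBall.origin d))

/-- `γ(∞) D_δ`, a factor of `I - T* T`. -/
noncomputable def inputMap (T : Col d H →L[ℂ] H) (γ : ModelTriple (isometricPart T) Jinf J0) :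
    Jinf →L[ℂ] Col d H :=
  γ.mapInf ∘L defect (zeroPoint T γ)

theorem adjoint_outputMap (T : Col d H →L[ℂ] H) (γ : ModelTriple (isometricPart T) Jinf J0) :
    adjoint (outputMap T γ) =
      γ.map (CBall.origin d) ∘L defect (adjoint (zeroPoint T γ)) := by
  rw [outputMap, adjoint_comp, adjoint_adjoint, adjoint_defect]

theorem adjoint_inputMap (T : Col d H →L[ℂ] H) (γ : ModelTriple (isometricPart T) Jinf J0) :
    adjoint (inputMap T γ) = defect (zeroPoint T γ) ∘L adjoint γ.mapInf := by
  rw [inputMap, adjoint_comp, adjoint_defect]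

theorem adjoint_outputMap_comp_self (hT : ‖T‖ ≤ 1) (γ : ModelTriple (isometricPart T) Jinf J0) :
    adjoint (outputMap T γ) ∘L outputMap T γ = 1 - T ∘L adjoint T := by
  rw [adjoint_outputMap, outputMap, comp_assoc, ← comp_assoc (defect _),
    defect_comp_self (norm_adjoint_le_one (norm_zeroPoint_le hT γ)), adjoint_adjoint,
    map_origin_comp_one_sub_zeroPoint hT]

theorem inputMap_comp_adjoint (hT : ‖T‖ ≤ 1) (γ : ModelTriple (isometricPart T) Jinf J0) :
    inputMap T γ ∘L adjoint (inputMap T γ) = 1 - adjoint T ∘L T := by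
  rw [adjoint_inputMap, inputMap, comp_assoc, ← comp_assoc (defect _),
    defect_comp_self (norm_zeroPoint_le hT γ), mapInf_comp_one_sub_zeroPoint hT]

theorem outputMap_comp_adjoint (hT : ‖T‖ ≤ 1) (γ : ModelTriple (isometricPart T) Jinf J0) :
    outputMap T γ ∘L adjoint (outputMap T γ) + zeroPoint T γ ∘L adjoint (zeroPoint T γ) = 1 := by
  rw [adjoint_outputMap, outputMap, comp_assoc, adjoint_comp_comp_of_isometry γ.isometry_map_origin,
    defect_comp_self (norm_adjoint_le_one (norm_zeroPoint_le hT γ)), adjoint_adjoint,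
    sub_add_cancel]

theorem adjoint_inputMap_comp_self (hT : ‖T‖ ≤ 1) (γ : ModelTriple (isometricPart T) Jinf J0) :
    adjoint (inputMap T γ) ∘L inputMap T γ + adjoint (zeroPoint T γ) ∘L zeroPoint T γ = 1 := by
  rw [adjoint_inputMap, inputMap, comp_assoc, adjoint_comp_comp_of_isometry γ.isometry_mapInf,
    defect_comp_self (norm_zeroPoint_le hT γ), sub_add_cancel]

theorem inputMap_comp_adjoint_zeroPoint (hT : ‖T‖ ≤ 1)
    (γ : ModelTriple (isometricPart T) Jinf J0) :
    inputMap T γ ∘L adjoint (zeroPoint T γ) = -(adjoint T ∘L adjoint (outputMap T γ)) := by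
  have h := defect_adjoint_comp (norm_adjoint_le_one (norm_zeroPoint_le hT γ))
  rw [adjoint_adjoint] at h
  rw [inputMap, comp_assoc, h, ← comp_assoc, mapInf_comp_adjoint_zeroPoint hT, adjoint_outputMap,
    neg_comp, comp_assoc]

theorem comp_inputMap_add (hT : ‖T‖ ≤ 1) (γ : ModelTriple (isometricPart T) Jinf J0) :
    T ∘L inputMap T γ + adjoint (outputMap T γ) ∘L zeroPoint T γ = 0 := by
  rw [adjoint_outputMap, comp_assoc, defect_adjoint_comp (norm_zeroPoint_le hT γ), ← comp_assoc,
    map_origin_comp_zeroPoint hT, inputMap, neg_comp, comp_assoc, add_neg_cancel]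

end ZeroPoint

/-! ### The model characteristic function as a transfer function. -/

section ModelCharFun

variable {d : ℕ} {H : Type u} {Jinf : Type v} {J0 : Type w}
  [NormedAddCommGroup H] [InnerProductSpace ℂ H] [CompleteSpace H]
  [NormedAddCommGroup Jinf] [InnerProductSpace ℂ Jinf] [CompleteSpace Jinf]
  [NormedAddCommGroup J0] [InnerProductSpace ℂ J0] [CompleteSpace J0]
  {T : Col d H →L[ℂ] H}

/-- `T* = V* - γ(∞) δ* γ(0)*` is a feedback perturbation of `V*`. The resolvent identity inverts `I
+ δ* b_V(z)` explicitly, replacing the resolvent of `V` by that of `T`. -/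
theorem add_zeroPoint_comp_inverse (hT : ‖T‖ ≤ 1) (γ : ModelTriple (isometricPart T) Jinf J0)
    (z : CBall d) :
    (γ.charFun z + zeroPoint T γ) ∘L Ring.inverse (1 + adjoint (zeroPoint T γ) ∘L γ.charFun z) =
      zeroPoint T γ + (1 - zeroPoint T γ ∘L adjoint (zeroPoint T γ)) ∘L
        adjoint (γ.map (CBall.origin d)) ∘L rowResolvent T z ∘L pointRow H z ∘L γ.mapInf := by
  have hV1 := norm_isometricPart_le hT
  have hV := isometricPart_comp_adjoint_comp_self hT
  rw [γ.charFun_eq hV hV1]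
  set δ := zeroPoint T γ with hδ
  set g := γ.map (CBall.origin d) with hg
  set R := rowResolvent (isometricPart T) z with hR
  set S := rowResolvent T z with hS
  set E := pointRow H z ∘L γ.mapInf with hE
  set Y := adjoint δ ∘L adjoint g with hY
  -- `E Y = z γ(∞) δ* γ(0)*` is the difference of the operators inverted by `S` and `R`; multiplying
  -- by both resolvents in either order gives `R - S`.
  have hEY : E ∘L Y = (1 - pointRow H z ∘L adjoint T) -
      (1 - pointRow H z ∘L adjoint (isometricPart T)) := by
    have h := congrArg (fun A => pointRow H z ∘L adjoint A) (eq_isometricPart_sub hT γ)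
    simp only [map_sub, adjoint_comp, adjoint_adjoint, comp_sub] at h
    rw [h, hE, hY]
    simp only [comp_assoc, sub_sub_sub_cancel_left, sub_sub_cancel]
    rfl
  have hRS : R ∘L E ∘L Y ∘L S = R - S := by
    rw [← comp_assoc E, hEY, sub_comp, comp_sub, one_sub_comp_rowResolvent hT, ← comp_assoc,
      rowResolvent_comp_one_sub hV1]
    rfl
  have hSR : S ∘L E ∘L Y ∘L R = R - S := by
    rw [← comp_assoc E, hEY, sub_comp, comp_sub, one_sub_comp_rowResolvent hV1, ← comp_assoc,
      rowResolvent_comp_one_sub hT]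
    rfl
  have hREinv : (R ∘L E) ∘L (1 - Y ∘L S ∘L E) = S ∘L E := by
    have h1 : (R ∘L E) ∘L Y ∘L S ∘L E = (R ∘L E ∘L Y ∘L S) ∘L E := by simp only [comp_assoc]
    rw [comp_sub, h1, hRS, sub_comp]
    exact sub_sub_cancel _ _
  have hSEinv : (S ∘L E) ∘L (1 + Y ∘L R ∘L E) = R ∘L E := by
    have h1 : (S ∘L E) ∘L Y ∘L R ∘L E = (S ∘L E ∘L Y ∘L R) ∘L E := by simp only [comp_assoc]
    rw [comp_add, h1, hSR, sub_comp]
    exact add_sub_cancel _ _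
  have hinv1 : (1 + Y ∘L R ∘L E) * (1 - Y ∘L S ∘L E) = 1 := by
    rw [add_mul, one_mul]
    change 1 - Y ∘L S ∘L E + Y ∘L ((R ∘L E) ∘L (1 - Y ∘L S ∘L E)) = 1
    rw [hREinv, sub_add_cancel]
  have hinv2 : (1 - Y ∘L S ∘L E) * (1 + Y ∘L R ∘L E) = 1 := by
    rw [sub_mul, one_mul]
    change 1 + Y ∘L R ∘L E - Y ∘L ((S ∘L E) ∘L (1 + Y ∘L R ∘L E)) = 1
    rw [hSEinv, add_sub_cancel_right]
  have hinv : Ring.inverse (1 + Y ∘L R ∘L E) = 1 - Y ∘L S ∘L E :=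
    Ring.inverse_unit ⟨1 + Y ∘L R ∘L E, 1 - Y ∘L S ∘L E, hinv1, hinv2⟩
  have hb : adjoint δ ∘L adjoint g ∘L R ∘L E = Y ∘L R ∘L E := by rw [hY, comp_assoc]
  rw [hb, hinv, add_comp, comp_assoc (adjoint g), hREinv, comp_sub, sub_comp]
  have h1 : δ ∘L (1 : Jinf →L[ℂ] Jinf) = δ := rfl
  have h2 : (1 : J0 →L[ℂ] J0) ∘L adjoint g ∘L S ∘L E = adjoint g ∘L S ∘L E := rfl
  rw [h1, h2, hY]
  simp only [comp_assoc]
  abel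

/-- `δ D_δ = D_{δ*} δ` and `I - δ δ* = D_{δ*}²` pull a factor `D_{δ*}` out on the left; injectivity
of `D_{δ*}` cancels it. -/
theorem isModelCharFun_iff (hT : ‖T‖ ≤ 1) (γ : ModelTriple (isometricPart T) Jinf J0)
    (c : CBall d → Jinf →L[ℂ] J0) :
    IsModelCharFun T γ c ↔
      c = transferFunction T (inputMap T γ) (outputMap T γ) (zeroPoint T γ) := by
  have h : ∀ z, (γ.charFun z + zeroPoint T γ) ∘L
      Ring.inverse (1 + adjoint (zeroPoint T γ) ∘L γ.charFun z) ∘L defect (zeroPoint T γ) =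
      defect (adjoint (zeroPoint T γ)) ∘L
        transferFunction T (inputMap T γ) (outputMap T γ) (zeroPoint T γ) z := fun z => by
    have h1 := defect_comp_self (norm_adjoint_le_one (norm_zeroPoint_le hT γ))
    rw [adjoint_adjoint] at h1
    rw [← comp_assoc, add_zeroPoint_comp_inverse hT, transferFunction, comp_add,
      defect_adjoint_comp (norm_zeroPoint_le hT γ), add_comp, ← h1, outputMap, inputMap]
    simp only [comp_assoc]
  constructor
  · intro hc
    funext z
    ext1 u
    refine sub_eq_zero.mp (eq_zero_of_defect_adjoint_zeroPoint hT γ ?_)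
    have := (hc z).trans (h z)
    rw [map_sub, sub_eq_zero]
    exact congrArg (fun S : Jinf →L[ℂ] J0 => S u) this
  · rintro rfl z
    exact (h z).symm

theorem IsModelCharFun.isRealization (hT : ‖T‖ ≤ 1) {γ : ModelTriple (isometricPart T) Jinf J0}
    {c : CBall d → Jinf →L[ℂ] J0} (hc : IsModelCharFun T γ c) :
    IsRealization T (outputMap T γ) c := by
  rw [(isModelCharFun_iff hT γ c).mp hc]
  refine ⟨adjoint_outputMap_comp_self hT γ, fun k hk => ?_,
    one_sub_transferFunction_comp_adjoint hT (inputMap_comp_adjoint hT γ)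
      (inputMap_comp_adjoint_zeroPoint hT γ) (outputMap_comp_adjoint hT γ)⟩
  rw [adjoint_outputMap] at hk
  exact eq_zero_of_defect_adjoint_zeroPoint hT γ
    (γ.isometry_map_origin.injective (hk.trans (map_zero _).symm))

theorem IsModelCharFun.norm_apply_lt (hT : ‖T‖ ≤ 1) {γ : ModelTriple (isometricPart T) Jinf J0}
    {c : CBall d → Jinf →L[ℂ] J0} (hc : IsModelCharFun T γ c) (z : CBall d) {u : Jinf}
    (hu : u ≠ 0) : ‖c z u‖ < ‖u‖ := by
  rw [(isModelCharFun_iff hT γ c).mp hc]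
  refine norm_transferFunction_apply_lt hT ?_ (comp_inputMap_add hT γ)
    (adjoint_inputMap_comp_self hT γ) ?_ z hu
  · rw [adjoint_outputMap_comp_self hT, add_sub_cancel]
  · refine γ.isometry_mapInf.injective.comp ((injective_iff_map_eq_zero _).mpr fun x hx => ?_)
    exact eq_zero_of_defect_zeroPoint hT γ hx

end ModelCharFun

/-! ### From a realization to a Schur function and a Gleason model. -/

section ModelConstruction

variable {d : ℕ} {H J K : Type*}
  [NormedAddCommGroup H] [InnerProductSpace ℂ H] [CompleteSpace H]
  [NormedAddCommGroup J] [InnerProductSpace ℂ J] [CompleteSpace J]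
  [NormedAddCommGroup K] [InnerProductSpace ℂ K] [CompleteSpace K]
  {T : Col d H →L[ℂ] H} {C : H →L[ℂ] K}

theorem IsRealization.inv_smul_one_sub {b : CBall d → J →L[ℂ] K} (h : IsRealization T C b)
    (z w : CBall d) :
    (1 - inner ℂ w.1 z.1 : ℂ)⁻¹ • (1 - b z ∘L adjoint (b w)) =
      (C ∘L rowResolvent T z) ∘L adjoint (C ∘L rowResolvent T w) := by
  rw [h.one_sub_comp_adjoint, smul_smul, inv_mul_cancel₀ (one_sub_inner_ne_zero z w), one_smul]

/-- Dividing by `1 - z w*` splits the Szegő kernel as `b(z) b(w)* / (1 - z w*)` plus a Gram kernel.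
Thus `k_z k ↦ k_z b(z)* k` is a contraction, and its adjoint is multiplication by `b`. -/
theorem IsRealization.exists_multiplier {b : CBall d → J →L[ℂ] K} (h : IsRealization T C b) :
    ∃ M : DruryArveson d J →L[ℂ] DruryArveson d K, ‖M‖ ≤ 1 ∧
      ∀ (f : DruryArveson d J) (z : CBall d), M f z = b z (f z) := by
  have hJ : ∀ z w, adjoint (RKHS.kerFun (DruryArveson d J) z) ∘L RKHS.kerFun (DruryArveson d J) w =
      (1 - inner ℂ w.1 z.1 : ℂ)⁻¹ • (1 : J →L[ℂ] J) := fun z w => by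
    rw [← RKHS.kernel_apply, kernel_druryArveson, szegoKernel, Matrix.of_apply]
  have hK : ∀ z w, adjoint (RKHS.kerFun (DruryArveson d K) z) ∘L RKHS.kerFun (DruryArveson d K) w =
      (1 - inner ℂ w.1 z.1 : ℂ)⁻¹ • (1 : K →L[ℂ] K) := fun z w => by
    rw [← RKHS.kernel_apply, kernel_druryArveson, szegoKernel, Matrix.of_apply]
  obtain ⟨L, hL, hLe⟩ := exists_contraction_of_gram_eq_add
    (e := fun z => RKHS.kerFun (DruryArveson d K) z)
    (f := fun z => RKHS.kerFun (DruryArveson d J) z ∘L adjoint (b z))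
    (g := fun z => adjoint (C ∘L rowResolvent T z))
    (fun z w => by
      rw [hK, adjoint_comp, adjoint_adjoint, adjoint_adjoint, ← h.inv_smul_one_sub, comp_assoc,
        ← comp_assoc (adjoint (RKHS.kerFun (DruryArveson d J) z)), hJ, smul_comp, comp_smul,
        ← smul_add]
      congr 1
      exact (add_sub_cancel _ _).symm)
    (fun f hf => RKHS.ext fun z => by
      rw [← RKHS.adjoint_kerFun, hf, RKHS.coe_zero, Pi.zero_apply])
  refine ⟨adjoint L, norm_adjoint_le_one hL, fun f z => ext_inner_left ℂ fun k => ?_⟩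
  rw [← RKHS.kerFun_inner, adjoint_inner_right, hLe, comp_apply, RKHS.kerFun_inner,
    adjoint_inner_left]

theorem IsRealization.exists_isExtremalGleasonSolution {b : SchurClass d J K}
    (h : IsRealization T C b) (hT : ‖T‖ ≤ 1) (hcnc : IsCCNC T) :
    ∃ X : Col d (DeBrangesRovnyak b) →L[ℂ] DeBrangesRovnyak b,
      IsExtremalGleasonSolution b X ∧ RowUnitarilyEquivalent T X := by
  -- Both families have Gram operators `k^b(z, w)`; CCNC is the density of the first, and point
  -- evaluations give that of the second.
  obtain ⟨U, hU⟩ := exists_linearIsometryEquiv_of_gram_eq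
    (e := fun z => adjoint (C ∘L rowResolvent T z))
    (f := fun z => RKHS.kerFun (DeBrangesRovnyak b) z)
    (fun z w => by
      rw [adjoint_adjoint, ← h.inv_smul_one_sub, ← RKHS.kernel_apply, kernel_deBrangesRovnyak,
        dBRKernel, Matrix.of_apply])
    (fun x hx => (isCCNC_iff hT h.adjoint_comp_self).mp hcnc x fun z => by
      simpa only [adjoint_adjoint, comp_apply] using hx z)
    (fun f hf => RKHS.ext fun z => by
      rw [← RKHS.adjoint_kerFun, hf, RKHS.coe_zero, Pi.zero_apply])
  have hev : ∀ (z : CBall d) (x : H), (U x) z = C (rowResolvent T z x) := fun z x =>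
    ext_inner_left ℂ fun k => by
      rw [← RKHS.kerFun_inner, ← hU, U.inner_map_map, adjoint_inner_left, comp_apply]
  set Uc : H →L[ℂ] DeBrangesRovnyak b := U.toContinuousLinearEquiv.toContinuousLinearMap with hUc
  set A := LinearIsometryEquiv.piLpCongrRight (𝕜 := ℂ) 2 (fun _ : Fin d => U) with hA
  set X : Col d (DeBrangesRovnyak b) →L[ℂ] DeBrangesRovnyak b :=
    Uc ∘L T ∘L A.symm.toContinuousLinearEquiv.toContinuousLinearMap with hX
  have hUX : ∀ x, U (T x) = X (A x) := fun x => by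
    change U (T x) = U (T (A.symm (A x)))
    rw [A.symm_apply_apply]
  -- Since `U C* = k₀`, conjugating `T T* = I - C* C` by `U` gives extremality.
  have hXX : X ∘L adjoint X = 1 - RKHS.kerFun (DeBrangesRovnyak b) (CBall.origin d) ∘L
      adjoint (RKHS.kerFun (DeBrangesRovnyak b) (CBall.origin d)) := by
    refine ContinuousLinearMap.ext fun f => ?_
    obtain ⟨x, rfl⟩ := U.surjective f
    rw [comp_apply, comp_adjoint_apply_of_rowUnitarilyEquivalent hUX, sub_apply,
      one_apply_eq_self, comp_apply, RKHS.adjoint_kerFun, hev, ← hU, ← map_sub,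
      rowResolvent_origin]
    congr 1
    have := congrArg (fun S : H →L[ℂ] H => S x) h.adjoint_comp_self
    simp only [comp_apply, sub_apply, one_apply_eq_self] at this
    have h1 : adjoint (C ∘L (1 : H →L[ℂ] H)) (C ((1 : H →L[ℂ] H) x)) = adjoint C (C x) := rfl
    rw [h1, this, sub_sub_cancel]
  refine ⟨X, ⟨⟨fun f z => ?_, hXX.le⟩, hXX⟩, U, hUX⟩
  obtain ⟨x, rfl⟩ := U.surjective f
  have h1 := congrArg (fun S : H →L[ℂ] H => C (S x)) (rowResolvent_comp_one_sub hT z)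
  simp only [comp_apply, sub_apply, one_apply_eq_self, map_sub] at h1
  rw [← pointRow_apply_apply, pointRow_adjoint_apply_of_rowUnitarilyEquivalent hUX, hev, hev, hev,
    rowResolvent_origin, one_apply_eq_self, ← h1, sub_sub_cancel]

end ModelConstruction

/-! ### Weak coincidence is symmetric and transitive. -/

section CoincidenceRelation

variable {d : ℕ}
  {J₁ : Type*} [NormedAddCommGroup J₁] [InnerProductSpace ℂ J₁] [CompleteSpace J₁]
  {K₁ : Type*} [NormedAddCommGroup K₁] [InnerProductSpace ℂ K₁] [CompleteSpace K₁]
  {J₂ : Type*} [NormedAddCommGroup J₂] [InnerProductSpace ℂ J₂] [CompleteSpace J₂]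
  {K₂ : Type*} [NormedAddCommGroup K₂] [InnerProductSpace ℂ K₂] [CompleteSpace K₂]
  {J₃ : Type*} [NormedAddCommGroup J₃] [InnerProductSpace ℂ J₃] [CompleteSpace J₃]
  {K₃ : Type*} [NormedAddCommGroup K₃] [InnerProductSpace ℂ K₃] [CompleteSpace K₃]
  {b₁ : CBall d → J₁ →L[ℂ] K₁} {b₂ : CBall d → J₂ →L[ℂ] K₂} {b₃ : CBall d → J₃ →L[ℂ] K₃}

theorem CoincideWeakly.symm (h : CoincideWeakly b₁ b₂) : CoincideWeakly b₂ b₁ := by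
  obtain ⟨R, Q, h⟩ := h
  refine ⟨R.symm, Q.symm, fun z x => ?_⟩
  rw [R.symm_apply_eq, h, Q.apply_symm_apply]

theorem CoincideWeakly.trans (h : CoincideWeakly b₁ b₂) (h' : CoincideWeakly b₂ b₃) :
    CoincideWeakly b₁ b₃ := by
  obtain ⟨R, Q, h⟩ := h
  obtain ⟨R', Q', h'⟩ := h'
  refine ⟨R.trans R', Q.trans Q', fun z x => ?_⟩
  rw [LinearIsometryEquiv.trans_apply, LinearIsometryEquiv.trans_apply, h, h']

end CoincidenceRelation

/-! ### The model theorem and the characteristic function. -/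

section CharacteristicFunction

variable {d : ℕ} {H : Type u} [NormedAddCommGroup H] [InnerProductSpace ℂ H] [CompleteSpace H]
  {T : Col d H →L[ℂ] H}

/-- The model triple of the partial isometric part of a row contraction. -/
noncomputable def canonicalTriple (hT : ‖T‖ ≤ 1) :
    ModelTriple (isometricPart T) (LinearMap.ker (isometricPart T).toLinearMap)
      (LinearMap.ker (adjoint (isometricPart T)).toLinearMap) :=
  ModelTriple.canonical (isometricPart_comp_adjoint_comp_self hT) (norm_isometricPart_le hT)

theorem exists_model_of_isCCNC [TopologicalSpace.SeparableSpace H] (hT : ‖T‖ ≤ 1)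
    (hcnc : IsCCNC T) :
    ∃ (J : Type u) (K : Type u)
        (_ : NormedAddCommGroup J) (_ : InnerProductSpace ℂ J) (_ : CompleteSpace J)
        (_ : TopologicalSpace.SeparableSpace J)
        (_ : NormedAddCommGroup K) (_ : InnerProductSpace ℂ K) (_ : CompleteSpace K)
        (_ : TopologicalSpace.SeparableSpace K)
        (b : SchurClass d J K) (X : Col d (DeBrangesRovnyak b) →L[ℂ] DeBrangesRovnyak b),
        b.IsPurelyContractive ∧ IsExtremalGleasonSolution b X ∧ RowUnitarilyEquivalent T X := by
  set γ := canonicalTriple hT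
  have hc := (isModelCharFun_iff hT γ _).mpr rfl
  have hr := hc.isRealization hT
  let b : SchurClass d (LinearMap.ker (isometricPart T).toLinearMap)
      (LinearMap.ker (adjoint (isometricPart T)).toLinearMap) := ⟨_, hr.exists_multiplier⟩
  have hb : IsRealization T (outputMap T γ) b := hr
  obtain ⟨X, hX, hTX⟩ := hb.exists_isExtremalGleasonSolution hT hcnc
  -- Second countability passes to subspaces, so the coefficient spaces `ker V` and `ker V*` are
  -- separable.
  have : SecondCountableTopology H := UniformSpace.secondCountable_of_separable H
  have : SecondCountableTopology (Col d H) :=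
    (PiLp.homeomorph 2 (fun _ : Fin d => H)).secondCountableTopology
  exact ⟨_, _, _, _, inferInstance, inferInstance, _, _, inferInstance, inferInstance, b, X,
    fun z u hu => hc.norm_apply_lt hT z hu, hX, hTX⟩

theorem IsRealization.isCharacteristicFunction {J : Type v} {K : Type w}
    [NormedAddCommGroup J] [InnerProductSpace ℂ J] [CompleteSpace J]
    [NormedAddCommGroup K] [InnerProductSpace ℂ K] [CompleteSpace K]
    {b : SchurClass d J K} {C : H →L[ℂ] K} (hT : ‖T‖ ≤ 1) (h : IsRealization T C b) :
    IsCharacteristicFunction T b := by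
  have hc := (isModelCharFun_iff hT (canonicalTriple hT) _).mpr rfl
  exact ⟨_, _, _, _, inferInstance, _, _, inferInstance, canonicalTriple hT, _, hc,
    h.coincideWeakly (hc.isRealization hT)⟩

end CharacteristicFunction

theorem theorem4 (d : ℕ) (H : Type u) [NormedAddCommGroup H] [InnerProductSpace ℂ H]
    [CompleteSpace H] [TopologicalSpace.SeparableSpace H]
    (T : Col d H →L[ℂ] H) (hT : ‖T‖ ≤ 1) :
    -- the model theorem
    (IsCCNC T ↔
      ∃ (J : Type u) (K : Type u)
        (_ : NormedAddCommGroup J) (_ : InnerProductSpace ℂ J) (_ : CompleteSpace J)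
        (_ : TopologicalSpace.SeparableSpace J)
        (_ : NormedAddCommGroup K) (_ : InnerProductSpace ℂ K) (_ : CompleteSpace K)
        (_ : TopologicalSpace.SeparableSpace K)
        (b : SchurClass d J K) (X : Col d (DeBrangesRovnyak b) →L[ℂ] DeBrangesRovnyak b),
        b.IsPurelyContractive ∧ IsExtremalGleasonSolution b X ∧ RowUnitarilyEquivalent T X) ∧
    -- the multiplier of any such model is the characteristic function of `T`
    (∀ (J : Type v) (K : Type w)
        [NormedAddCommGroup J] [InnerProductSpace ℂ J] [CompleteSpace J]
        [TopologicalSpace.SeparableSpace J]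
        [NormedAddCommGroup K] [InnerProductSpace ℂ K] [CompleteSpace K]
        [TopologicalSpace.SeparableSpace K]
        (b : SchurClass d J K) (X : Col d (DeBrangesRovnyak b) →L[ℂ] DeBrangesRovnyak b),
        b.IsPurelyContractive → IsExtremalGleasonSolution b X → RowUnitarilyEquivalent T X →
          IsCharacteristicFunction T b) ∧
    -- the characteristic function is a unitary invariant
    (∀ (H' : Type v) [NormedAddCommGroup H'] [InnerProductSpace ℂ H'] [CompleteSpace H']
        [TopologicalSpace.SeparableSpace H']
        (T' : Col d H' →L[ℂ] H'), ‖T'‖ ≤ 1 →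
        IsCCNC T → IsCCNC T' → RowUnitarilyEquivalent T T' →
        ∀ (J K J' K' : Type w)
          [NormedAddCommGroup J] [InnerProductSpace ℂ J] [CompleteSpace J]
          [TopologicalSpace.SeparableSpace J]
          [NormedAddCommGroup K] [InnerProductSpace ℂ K] [CompleteSpace K]
          [TopologicalSpace.SeparableSpace K]
          [NormedAddCommGroup J'] [InnerProductSpace ℂ J'] [CompleteSpace J']
          [TopologicalSpace.SeparableSpace J']
          [NormedAddCommGroup K'] [InnerProductSpace ℂ K'] [CompleteSpace K']
          [TopologicalSpace.SeparableSpace K']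
          (b : SchurClass d J K) (b' : SchurClass d J' K'),
          IsCharacteristicFunction T b → IsCharacteristicFunction T' b' →
            CoincideWeakly b b') := by
  refine ⟨⟨exists_model_of_isCCNC hT, ?_⟩, ?_, ?_⟩
  · rintro ⟨J, K, _, _, _, _, _, _, _, _, b, X, -, hX, U, hU⟩
    exact isCCNC_of_isExtremalGleasonSolution hT hX hU
  · rintro J K _ _ _ _ _ _ _ _ b X hb hX ⟨U, hU⟩
    exact (IsRealization.of_isExtremalGleasonSolution hT hb hX hU).isCharacteristicFunction hT
  · rintro H' _ _ _ _ T' hT' - - ⟨U, hU⟩ J K J' K' _ _ _ _ _ _ _ _ _ _ _ _ _ _ _ _ b b'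
      ⟨Jinf, J0, _, _, _, _, _, _, γ, c, hc, hbc⟩ ⟨Jinf', J0', _, _, _, _, _, _, γ', c', hc', hbc'⟩
    -- The realization of `T'` by `c'` becomes one of `T` by the same `c'`, so uniqueness for the
    -- single operator `T` compares `c` with `c'`.
    have h := (hc'.isRealization hT').of_rowUnitarilyEquivalent hT hT' hU
    exact hbc.trans (((hc.isRealization hT).coincideWeakly h).trans hbc'.symm)
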